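/- Let $\mathcal V$ be a complete and cocomplete symmetric monoidal closed category, with unit $I$, internal hom $[-,-]$ and underlying ordinary category locally small, equipped with a model structure making it a monoidal model category (the pushout-product $i\,\square\,j$ of two cofibrations is a cofibration, and is a weak equivalence if $i$ or $j$ is one), and suppose that $I$ is cofibrant. We use the following notions. An *interval* is a factorisation $I+I\xrightarrow{(d\ c)}J\xrightarrow{e}I$ of the codiagonal with $(d\ c)$ a cofibration and $e$ a weak equivalence. A morphism $f\colon X\to Y$ of $\mathcal V$ is *shrinkable* if there are a morphism $s\colon Y\to X$ with $fs=1_Y$, an interval $(J,d,c,e)$ and a morphism $h\colon J\to[X,X]$ such that $hd$ and $hc$ are the names $I\to[X,X]$ of $sf$ and $1_X$, and $[X,f]\circ h\colon J\to[X,Y]$ is the composite of $e$ with the name $I\to[X,Y]$ of $f$. Let $\mathcal E$ be the class of shrinkable morphisms. A $\mathcal V$-functor $U\colon\mathcal B\to\mathcal A$ has an *$\mathcal E$-weak left adjoint* if for each $A\in\mathcal A$ there are $A'\in\mathcal B$ and $\eta\colon A\to UA'$ such that for all $B\in\mathcal B$ the composite $\mathcal B(A',B)\xrightarrow{U}\mathcal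 A(UA',UB)\xrightarrow{\mathcal A(\eta,UB)}\mathcal A(A,UB)$ belongs to $\mathcal E$. For a small $\mathcal V$-category $\mathcal D$, a $\mathcal V$-natural transformation between $\mathcal V$-functors $\mathcal D\to\mathcal V$ is a trivial fibration if all its components are trivial fibrations in $\mathcal V$; a $\mathcal V$-functor (weight) $Q\colon\mathcal D\to\mathcal V$ is *cofibrant* if $[\mathcal D,\mathcal V](Q,p)$ is a trivial fibration in $\mathcal V$ for every trivial fibration $p$. Let $\mathcal I$ be the unit $\mathcal V$-category (one object, with endomorphism object $I$), and let $I\colon\mathcal I\to\mathcal V$ be the $\mathcal V$-functor selecting $I$. A $\mathcal V$-category $\mathcal B$ has *enough cofibrantly-weighted limits* if for each small $\mathcal V$-category $\mathcal D$ and each $\mathcal V$-functor $P\colon\mathcal D\to\mathcal I$ there is a chosen cofibrant weight $Q\colon\mathcal D\to\mathcal V$ with a trivial fibration $Q\to IP$ such that $\mathcal B$ has all $Q$-weighted limits; a $\mathcal V$-functor $U\colon\mathcal B\to\mathcal A$ *preserves* them if it preserves these $Q$-weighted limits. **Theorem.** Let $\mathcal B$ be a $\mathcal V$-category with powers (by all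 objects of $\mathcal V$) and enough cofibrantly-weighted limits, let $\mathcal A$ be a $\mathcal V$-category, and let $U\colon\mathcal B\to\mathcal A$ be a $\mathcal V$-functor that preserves the powers and the chosen cofibrantly-weighted limits. Then $U$ has an $\mathcal E$-weak left adjoint if and only if the underlying ordinary functor $U_0\colon\mathcal B_0\to\mathcal A_0$ satisfies the solution set condition: for each $A\in\mathcal A$ there is a small family of morphisms $f_i\colon A\to UB_i$ such that each morphism $A\to UB$ is of the form $Ug\circ f_i$ for some $i$ and some $g\colon B_i\to B$. -/

import Mathlib

open CategoryTheory Limits MonoidalCategory HomotopicalAlgebra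
open scoped CategoryTheory.MonoidalClosed

universe v u u₁ u₂

noncomputable section

namespace WeakAFT

/-! ### Monoidal model categories with cofibrant unit -/

/-- The compatibility between a closed symmetric monoidal structure and a model structure: the
pushout-product `i □ j` of two cofibrations is a cofibration, which is moreover a weak equivalence
if `i` or `j` is one; and the unit object is cofibrant. (The usual unit axiom of monoidal model
categories is automatic when the unit is cofibrant.) -/
class MonoidalModelCategory (V : Type u) [Category.{v} V] [MonoidalCategory V]
    [ModelCategory V] : Prop where
  cofibration_pushoutProduct {A B X Y : V} (i : A ⟶ B) (j : X ⟶ Y)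
    (hi : cofibrations V i) (hj : cofibrations V j) :
    cofibrations V ((Arrow.pushoutProduct.obj (Arrow.mk i)).obj (Arrow.mk j)).hom
  weakEquivalence_pushoutProduct_left {A B X Y : V} (i : A ⟶ B) (j : X ⟶ Y)
    (hi : trivialCofibrations V i) (hj : cofibrations V j) :
    weakEquivalences V ((Arrow.pushoutProduct.obj (Arrow.mk i)).obj (Arrow.mk j)).hom
  weakEquivalence_pushoutProduct_right {A B X Y : V} (i : A ⟶ B) (j : X ⟶ Y)
    (hi : cofibrations V i) (hj : trivialCofibrations V j) :
    weakEquivalences V ((Arrow.pushoutProduct.obj (Arrow.mk i)).obj (Arrow.mk j)).hom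
  isCofibrant_unit : IsCofibrant (𝟙_ V)

/-! ### Intervals and shrinkable morphisms -/

section Shrinkable

variable (V : Type u) [Category.{v} V] [MonoidalCategory V] [ModelCategory V]

/-- An interval: a factorisation `I + I ⟶ J ⟶ I` of the codiagonal of the unit object as a
cofibration followed by a weak equivalence. -/
structure Interval where
  /-- the underlying object -/
  J : V
  /-- the first endpoint -/
  d : 𝟙_ V ⟶ J
  /-- the second endpoint -/
  c : 𝟙_ V ⟶ J
  /-- the projection to the unit -/
  e : J ⟶ 𝟙_ V
  d_e : d ≫ e = 𝟙 _
  c_e : c ≫ e = 𝟙 _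
  cofibration_desc : cofibrations V (coprod.desc d c)
  weakEquivalence_e : weakEquivalences V e

/-- The shrinkable morphisms `f : X ⟶ Y` of `V` (regarded as a `V`-category): those admitting a
section `s`, together with a homotopy `h : J ⟶ [X, X]`, for some interval `J`, from `s ∘ f` to the
identity (`X ⟶ X` is transposed to `I ⟶ [X, X]` by `curry'`), such that `f ∘ h : J ⟶ [X, Y]` is
trivial, i.e. it is the constant homotopy at `f`. -/
def shrinkable [MonoidalClosed V] : MorphismProperty V := fun X Y f =>
  ∃ s : Y ⟶ X, s ≫ f = 𝟙 Y ∧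
    ∃ (J : Interval V) (h : J.J ⟶ (ihom X).obj X),
      J.d ≫ h = MonoidalClosed.curry' (f ≫ s) ∧
      J.c ≫ h = MonoidalClosed.curry' (𝟙 X) ∧
      h ≫ (ihom X).map f = J.e ≫ MonoidalClosed.curry' f

end Shrinkable

/-! ### Weak left adjoints -/

section WeakAdjoint

variable {V : Type u} [Category.{v} V] [MonoidalCategory V]
variable {A : Type u₂} [EnrichedCategory V A]

/-- Precomposition `A(Y, Z) ⟶ A(X, Z)` with a morphism `η : I ⟶ A(X, Y)` of the underlying
category. -/
def precomp {X Y : A} (η : 𝟙_ V ⟶ (X ⟶[V] Y)) (Z : A) : (Y ⟶[V] Z) ⟶ (X ⟶[V] Z) :=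
  (λ_ _).inv ≫ η ▷ _ ≫ eComp V X Y Z

variable {B : Type u₁} [EnrichedCategory V B]

/-- `η : X ⟶ U X'` is a weak reflection of `X` along `U` with respect to a class `E` of morphisms
of `V`: for all `Y`, the morphism `B(X', Y) ⟶ A(U X', U Y) ⟶ A(X, U Y)` induced by `U` and `η`
belongs to `E`. -/
def IsWeakReflection (E : MorphismProperty V) (U : EnrichedFunctor V B A) {X : A} {X' : B}
    (η : 𝟙_ V ⟶ (X ⟶[V] U.obj X')) : Prop :=
  ∀ Y : B, E (U.map X' Y ≫ precomp η (U.obj Y))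

/-- `U` has an `E`-weak left adjoint: every object has an `E`-weak reflection. -/
def HasWeakLeftAdjoint (E : MorphismProperty V) (U : EnrichedFunctor V B A) : Prop :=
  ∀ X : A, ∃ (X' : B) (η : 𝟙_ V ⟶ (X ⟶[V] U.obj X')), IsWeakReflection E U η

end WeakAdjoint

/-! ### Powers -/

section Powers

variable {V : Type u} [Category.{v} V] [MonoidalCategory V] [SymmetricCategory V]
  [MonoidalClosed V]
variable {B : Type u₁} [EnrichedCategory V B]

/-- The morphism `B(Z, P) ⟶ [X, B(Z, Y)]` induced by `ι : X ⟶ B(P, Y)`. -/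
def coneTranspose {X : V} {P Y : B} (ι : X ⟶ (P ⟶[V] Y)) (Z : B) :
    (Z ⟶[V] P) ⟶ (ihom X).obj (Z ⟶[V] Y) :=
  MonoidalClosed.curry ((β_ X (Z ⟶[V] P)).hom ≫ (Z ⟶[V] P) ◁ ι ≫ eComp V Z P Y)

/-- `ι : X ⟶ B(P, Y)` exhibits `P` as the power of `Y` by `X`. -/
def IsPower {X : V} {P Y : B} (ι : X ⟶ (P ⟶[V] Y)) : Prop :=
  ∀ Z : B, IsIso (coneTranspose ι Z)

variable (V B) in
/-- `B` has powers by all objects of `V`. -/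
def HasPowers : Prop :=
  ∀ (X : V) (Y : B), ∃ (P : B) (ι : X ⟶ (P ⟶[V] Y)), IsPower ι

/-- `U` preserves powers. -/
def PreservesPowers {A : Type u₂} [EnrichedCategory V A] (U : EnrichedFunctor V B A) : Prop :=
  ∀ ⦃X : V⦄ ⦃P Y : B⦄ (ι : X ⟶ (P ⟶[V] Y)), IsPower ι → IsPower (ι ≫ U.map P Y)

end Powers

/-! ### Auxiliary identities -/

section Aux

variable {V : Type u} [Category.{v} V] [MonoidalCategory V] [SymmetricCategory V]
variable {B : Type u₁} [EnrichedCategory V B]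

lemma comparison_aux {X L Y Y' : B} {q q' δ : V} (c : q ⟶ (L ⟶[V] Y)) (c' : q' ⟶ (L ⟶[V] Y'))
    (σ : δ ⟶ (Y ⟶[V] Y')) (a : q ⊗ δ ⟶ q')
    (h : a ≫ c' = c ▷ δ ≫ (L ⟶[V] Y) ◁ σ ≫ eComp V L Y Y') :
    q ◁ (β_ δ (X ⟶[V] L)).hom ≫ (α_ q (X ⟶[V] L) δ).inv ≫
        ((β_ q (X ⟶[V] L)).hom ≫ (X ⟶[V] L) ◁ c ≫ eComp V X L Y) ▷ δ ≫
          (X ⟶[V] Y) ◁ σ ≫ eComp V X Y Y' =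
      (α_ q δ (X ⟶[V] L)).inv ≫ a ▷ (X ⟶[V] L) ≫
        (β_ q' (X ⟶[V] L)).hom ≫ (X ⟶[V] L) ◁ c' ≫ eComp V X L Y' := by
  rw [BraidedCategory.braiding_naturality_left_assoc, ← MonoidalCategory.whiskerLeft_comp_assoc, h]
  simp only [MonoidalCategory.whiskerLeft_comp, comp_whiskerRight, Category.assoc,
    BraidedCategory.braiding_tensor_left_hom, Iso.inv_hom_id_assoc]
  rw [← e_assoc]
  simp only [← whisker_exchange_assoc, associator_inv_naturality_right_assoc,
    associator_inv_naturality_middle_assoc, Iso.hom_inv_id_assoc]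

end Aux

section Closed

variable {V : Type u} [Category.{v} V] [MonoidalCategory V] [MonoidalClosed V]

lemma uncurry_tensorHom_comp {S T x y z : V} (f : S ⟶ (ihom x).obj y) (g : T ⟶ (ihom y).obj z) :
    MonoidalClosed.uncurry ((f ⊗ₘ g) ≫ MonoidalClosed.comp x y z) =
      (α_ x S T).inv ≫ MonoidalClosed.uncurry f ▷ T ≫ MonoidalClosed.uncurry g := by
  rw [MonoidalClosed.uncurry_natural_left, MonoidalClosed.comp_eq, MonoidalClosed.uncurry_curry,
    MonoidalClosed.compTranspose_eq, MonoidalCategory.tensorHom_def]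
  simp only [MonoidalClosed.uncurry_eq, MonoidalCategory.whiskerLeft_comp, Category.assoc,
    comp_whiskerRight]
  rw [← associator_inv_naturality_middle_assoc, ← whisker_exchange_assoc,
    associator_inv_naturality_right_assoc]

end Closed

/-! ### Weights and the presheaf category `[D, V]` -/

section Weights

variable {V : Type u} [Category.{v} V] [MonoidalCategory V] [MonoidalClosed V]
variable {D : Type v} [EnrichedCategory V D]

variable (V D) in
/-- A weight on the small `V`-category `D` is a `V`-functor from `D` to `V`. -/
abbrev Weight := EnrichedFunctor V D V

/-- The action `D(d, d') ⟶ [F d, F d']` of a weight `F` on hom-objects. -/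
def Weight.hom (F : Weight V D) (d d' : D) : (d ⟶[V] d') ⟶ (ihom (F.obj d)).obj (F.obj d') :=
  F.map d d'

/-- A `V`-natural transformation `F ⟶ G` between weights, in terms of the components
`F d ⟶ G d`; naturality is the equality of two morphisms `D(d, d') ⟶ [F d, G d']`. -/
structure WeightHom (F G : Weight V D) where
  /-- the components -/
  app (d : D) : F.obj d ⟶ G.obj d
  naturality (d d' : D) :
    F.hom d d' ≫ (ihom (F.obj d)).map (app d') =
      G.hom d d' ≫ (MonoidalClosed.pre (app d)).app (G.obj d')

lemma WeightHom.uncurry_naturality {F G : Weight V D} (p : WeightHom F G) (d d' : D) :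
    MonoidalClosed.uncurry (F.hom d d') ≫ p.app d' =
      p.app d ▷ _ ≫ MonoidalClosed.uncurry (G.hom d d') := by
  rw [← MonoidalClosed.uncurry_natural_right, p.naturality, MonoidalClosed.uncurry_pre_app]

/-- A `V`-natural transformation of weights is a trivial fibration if it is so levelwise. -/
def WeightHom.IsTrivialFibration [ModelCategory V] {F G : Weight V D} (p : WeightHom F G) : Prop :=
  ∀ d : D, trivialFibrations V (p.app d)

/-- `D(d, d') ⊗ [F d', G d'] ⟶ [F d, G d']`, given by the action of `F`. -/
def actLeft (F G : Weight V D) (d d' : D) :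
    (d ⟶[V] d') ⊗ (ihom (F.obj d')).obj (G.obj d') ⟶ (ihom (F.obj d)).obj (G.obj d') :=
  F.hom d d' ▷ _ ≫ MonoidalClosed.comp (F.obj d) (F.obj d') (G.obj d')

lemma uncurry_actLeft (F G : Weight V D) (d d' : D) {T : V}
    (φ : T ⟶ (ihom (F.obj d')).obj (G.obj d')) :
    MonoidalClosed.uncurry ((d ⟶[V] d') ◁ φ ≫ actLeft F G d d') =
      (α_ _ _ _).inv ≫ MonoidalClosed.uncurry (F.hom d d') ▷ T ≫ MonoidalClosed.uncurry φ := by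
  rw [actLeft, ← tensorHom_def'_assoc, uncurry_tensorHom_comp]

variable [SymmetricCategory V]

/-- `D(d, d') ⊗ [F d, G d] ⟶ [F d, G d']`, given by the action of `G`. -/
def actRight (F G : Weight V D) (d d' : D) :
    (d ⟶[V] d') ⊗ (ihom (F.obj d)).obj (G.obj d) ⟶ (ihom (F.obj d)).obj (G.obj d') :=
  (β_ _ _).hom ≫ _ ◁ G.hom d d' ≫ MonoidalClosed.comp (F.obj d) (G.obj d) (G.obj d')

lemma uncurry_actRight (F G : Weight V D) (d d' : D) {T : V}
    (φ : T ⟶ (ihom (F.obj d)).obj (G.obj d)) :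
    MonoidalClosed.uncurry ((d ⟶[V] d') ◁ φ ≫ actRight F G d d') =
      F.obj d ◁ (β_ _ _).hom ≫ (α_ _ _ _).inv ≫ MonoidalClosed.uncurry φ ▷ _ ≫
        MonoidalClosed.uncurry (G.hom d d') := by
  rw [actRight, BraidedCategory.braiding_naturality_right_assoc, ← tensorHom_def_assoc,
    MonoidalClosed.uncurry_natural_left, uncurry_tensorHom_comp]

variable [HasLimits V]

/-- One of the two morphisms `∏ d, [F d, G d] ⟶ ∏ (d, d'), [D(d, d'), [F d, G d']]` defining the
object of `V`-natural transformations; it is given by the action of `G`. -/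
def natMapRight (F G : Weight V D) :
    (∏ᶜ fun d : D => (ihom (F.obj d)).obj (G.obj d)) ⟶
      ∏ᶜ fun p : D × D => (ihom (p.1 ⟶[V] p.2)).obj ((ihom (F.obj p.1)).obj (G.obj p.2)) :=
  Pi.lift fun p => Pi.π _ p.1 ≫ MonoidalClosed.curry (actRight F G p.1 p.2)

/-- The other one of the two morphisms `∏ d, [F d, G d] ⟶ ∏ (d, d'), [D(d, d'), [F d, G d']]`; it
is given by the action of `F`. -/
def natMapLeft (F G : Weight V D) :
    (∏ᶜ fun d : D => (ihom (F.obj d)).obj (G.obj d)) ⟶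
      ∏ᶜ fun p : D × D => (ihom (p.1 ⟶[V] p.2)).obj ((ihom (F.obj p.1)).obj (G.obj p.2)) :=
  Pi.lift fun p => Pi.π _ p.2 ≫ MonoidalClosed.curry (actLeft F G p.1 p.2)

/-- The hom-object `[D, V](F, G)` of `V`-natural transformations: the end of the `[F d, G d]`,
constructed as an equalizer. -/
def natObj (F G : Weight V D) : V :=
  equalizer (natMapRight F G) (natMapLeft F G)

/-- The projections of the end `[D, V](F, G)`. -/
def natObjπ (F G : Weight V D) (d : D) : natObj F G ⟶ (ihom (F.obj d)).obj (G.obj d) :=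
  equalizer.ι (natMapRight F G) (natMapLeft F G) ≫ Pi.π _ d

lemma natObj_condition (F G : Weight V D) (d d' : D) :
    (d ⟶[V] d') ◁ natObjπ F G d ≫ actRight F G d d' =
      (d ⟶[V] d') ◁ natObjπ F G d' ≫ actLeft F G d d' := by
  apply MonoidalClosed.curry_injective
  rw [MonoidalClosed.curry_natural_left, MonoidalClosed.curry_natural_left]
  have h := congrArg (· ≫ Pi.π _ (d, d'))
    (equalizer.condition (natMapRight F G) (natMapLeft F G))
  simp only [natMapRight, natMapLeft, Category.assoc, Pi.lift_π] at h
  exact (Category.assoc _ _ _).trans (h.trans (Category.assoc _ _ _).symm)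

/-- The universal property of the end `[D, V](F, G)`. -/
def natObjLift {F G : Weight V D} {T : V} (φ : ∀ d : D, T ⟶ (ihom (F.obj d)).obj (G.obj d))
    (hφ : ∀ d d' : D, (d ⟶[V] d') ◁ φ d ≫ actRight F G d d' =
      (d ⟶[V] d') ◁ φ d' ≫ actLeft F G d d') : T ⟶ natObj F G :=
  equalizer.lift (Pi.lift φ) (by
    refine Pi.hom_ext _ _ fun p => ?_
    have h := congrArg MonoidalClosed.curry (hφ p.1 p.2)
    rw [MonoidalClosed.curry_natural_left, MonoidalClosed.curry_natural_left] at h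
    simpa [natMapRight, natMapLeft] using h)

@[simp]
lemma natObjLift_π {F G : Weight V D} {T : V} (φ : ∀ d : D, T ⟶ (ihom (F.obj d)).obj (G.obj d))
    (hφ : ∀ d d' : D, (d ⟶[V] d') ◁ φ d ≫ actRight F G d d' =
      (d ⟶[V] d') ◁ φ d' ≫ actLeft F G d d') (d : D) :
    natObjLift φ hφ ≫ natObjπ F G d = φ d :=
  (equalizer.lift_ι_assoc _ _ _).trans (Pi.lift_π _ _)

lemma natObj_hom_ext {F G : Weight V D} {T : V} {f g : T ⟶ natObj F G}
    (h : ∀ d, f ≫ natObjπ F G d = g ≫ natObjπ F G d) : f = g :=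
  equalizer.hom_ext (Pi.hom_ext _ _ fun d =>
    (Category.assoc _ _ _).trans ((h d).trans (Category.assoc _ _ _).symm))

/-- The morphism `[D, V](Q, p) : [D, V](Q, F) ⟶ [D, V](Q, G)` given by composition with a
`V`-natural transformation `p : F ⟶ G`. -/
def natObjMap (Q : Weight V D) {F G : Weight V D} (p : WeightHom F G) :
    natObj Q F ⟶ natObj Q G :=
  natObjLift (fun d => natObjπ Q F d ≫ (ihom (Q.obj d)).map (p.app d)) (fun d d' => by
    apply MonoidalClosed.uncurry_injective
    have h := congrArg MonoidalClosed.uncurry (natObj_condition Q F d d')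
    rw [uncurry_actRight, uncurry_actLeft] at h
    rw [uncurry_actRight, uncurry_actLeft, MonoidalClosed.uncurry_natural_right,
      MonoidalClosed.uncurry_natural_right, comp_whiskerRight_assoc, ← p.uncurry_naturality]
    simpa only [Category.assoc] using congrArg (· ≫ p.app d') h)

/-- A weight `Q` is cofibrant if `[D, V](Q, p)` is a trivial fibration in `V` for each (levelwise)
trivial fibration `p : F ⟶ G` of weights. -/
def IsCofibrantWeight [ModelCategory V] (Q : Weight V D) : Prop :=
  ∀ ⦃F G : Weight V D⦄ (p : WeightHom F G), p.IsTrivialFibration →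
    trivialFibrations V (natObjMap Q p)

end Weights

/-! ### Weighted limits -/

section WeightedLimits

variable {V : Type u} [Category.{v} V] [MonoidalCategory V] [MonoidalClosed V]
variable {B : Type u₁} [EnrichedCategory V B]

variable (V) in
/-- The representable `V`-functor `B(X, -) : B ⟶ V`. -/
def representable (X : B) : EnrichedFunctor V B V where
  obj Y := X ⟶[V] Y
  map Y Z := MonoidalClosed.curry (eComp V X Y Z)
  map_id Y := by
    apply MonoidalClosed.uncurry_injective
    rw [MonoidalClosed.uncurry_natural_left]
    erw [MonoidalClosed.uncurry_curry, MonoidalClosed.uncurry_curry]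
    rw [← Iso.inv_comp_eq_id, e_comp_id]
  map_comp Y Z W := by
    apply MonoidalClosed.uncurry_injective
    refine Eq.trans ?_ (uncurry_tensorHom_comp (MonoidalClosed.curry (eComp V X Y Z))
      (MonoidalClosed.curry (eComp V X Z W))).symm
    rw [MonoidalClosed.uncurry_natural_left, MonoidalClosed.uncurry_curry,
      MonoidalClosed.uncurry_curry, MonoidalClosed.uncurry_curry, e_assoc]

variable {D : Type v} [EnrichedCategory V D]

/-- A `Q`-weighted cone over `S : D ⟶ B` with vertex `L`: a `V`-natural transformation
`Q ⟶ B(L, S -)`. -/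
abbrev WeightedCone (Q : Weight V D) (S : EnrichedFunctor V D B) (L : B) :=
  WeightHom Q (S.comp V (representable V L))

lemma uncurry_hom_representable (S : EnrichedFunctor V D B) (X : B) (d d' : D) :
    MonoidalClosed.uncurry (Weight.hom (S.comp V (representable V X)) d d') =
      (X ⟶[V] S.obj d) ◁ S.map d d' ≫ eComp V X (S.obj d) (S.obj d') := by
  refine (MonoidalClosed.uncurry_natural_left (S.map d d')
    (MonoidalClosed.curry (eComp V X (S.obj d) (S.obj d')))).trans ?_
  rw [MonoidalClosed.uncurry_curry]

/-- The components `Q d ⟶ B(L, S d)` of a weighted cone. -/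
def WeightedCone.leg {Q : Weight V D} {S : EnrichedFunctor V D B} {L : B}
    (c : WeightedCone Q S L) (d : D) : Q.obj d ⟶ (L ⟶[V] S.obj d) :=
  c.app d

lemma WeightedCone.uncurry_naturality {Q : Weight V D} {S : EnrichedFunctor V D B} {L : B}
    (c : WeightedCone Q S L) (d d' : D) :
    MonoidalClosed.uncurry (Q.hom d d') ≫ c.leg d' =
      c.leg d ▷ _ ≫ (L ⟶[V] S.obj d) ◁ S.map d d' ≫ eComp V L (S.obj d) (S.obj d') :=
  (WeightHom.uncurry_naturality c d d').trans
    (congrArg (c.leg d ▷ _ ≫ ·) (uncurry_hom_representable S L d d'))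

variable {A : Type u₂} [EnrichedCategory V A]

/-- The image of a weighted cone under a `V`-functor `U`: the composite
`Q ⟶ B(L, S -) ⟶ A(U L, U S -)`. -/
def WeightedCone.map {Q : Weight V D} {S : EnrichedFunctor V D B} {L : B}
    (c : WeightedCone Q S L) (U : EnrichedFunctor V B A) :
    WeightedCone Q (S.comp V U) (U.obj L) where
  app d := c.leg d ≫ U.map L (S.obj d)
  naturality d d' := by
    have h : MonoidalClosed.uncurry (Q.hom d d') ≫ c.leg d' ≫ U.map L (S.obj d') =
        (c.leg d ≫ U.map L (S.obj d)) ▷ _ ≫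
          (U.obj L ⟶[V] U.obj (S.obj d)) ◁ (S.map d d' ≫ U.map (S.obj d) (S.obj d')) ≫
            eComp V (U.obj L) (U.obj (S.obj d)) (U.obj (S.obj d')) := by
      rw [← Category.assoc, c.uncurry_naturality]
      simp only [Category.assoc, U.map_comp, MonoidalCategory.tensorHom_def, comp_whiskerRight,
        MonoidalCategory.whiskerLeft_comp, whisker_exchange_assoc]
    apply MonoidalClosed.uncurry_injective
    rw [MonoidalClosed.uncurry_natural_right, MonoidalClosed.uncurry_pre_app]
    exact h.trans (congrArg ((c.leg d ≫ U.map L (S.obj d)) ▷ _ ≫ ·)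
      (uncurry_hom_representable (S.comp V U) (U.obj L) d d').symm)

variable [SymmetricCategory V]

variable [HasLimits V]

/-- The morphism `B(X, L) ⟶ [D, V](Q, B(X, S -))` induced by a `Q`-weighted cone with vertex `L`;
its components `B(X, L) ⟶ [Q d, B(X, S d)]` are given by composition with the components
`Q d ⟶ B(L, S d)` of the cone. -/
def WeightedCone.comparison {Q : Weight V D} {S : EnrichedFunctor V D B} {L : B}
    (c : WeightedCone Q S L) (X : B) :
    (X ⟶[V] L) ⟶ natObj Q (S.comp V (representable V X)) :=
  natObjLift (fun d => coneTranspose (c.leg d) X) (fun d d' => by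
    apply MonoidalClosed.uncurry_injective
    have h := comparison_aux (X := X) _ _ _ _ (c.uncurry_naturality d d')
    have e (d : D) : MonoidalClosed.uncurry (coneTranspose (c.leg d) X) =
      (β_ (Q.obj d) (X ⟶[V] L)).hom ≫ (X ⟶[V] L) ◁ c.leg d ≫ eComp V X L (S.obj d) :=
      MonoidalClosed.uncurry_curry _
    rw [← e, ← e, ← uncurry_hom_representable] at h
    exact (uncurry_actRight Q (S.comp V (representable V X)) d d'
      (coneTranspose (c.leg d) X)).trans (h.trans
      (uncurry_actLeft Q (S.comp V (representable V X)) d d' (coneTranspose (c.leg d') X)).symm))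

/-- The cone `c` exhibits `L` as the limit of `S` weighted by `Q`. -/
def WeightedCone.IsLimit {Q : Weight V D} {S : EnrichedFunctor V D B} {L : B}
    (c : WeightedCone Q S L) : Prop :=
  ∀ X : B, IsIso (c.comparison X)

variable (B) in
/-- `B` has all `Q`-weighted limits. -/
def HasWeightedLimits (Q : Weight V D) : Prop :=
  ∀ S : EnrichedFunctor V D B, ∃ (L : B) (c : WeightedCone Q S L), c.IsLimit

/-- `U` preserves `Q`-weighted limits. -/
def PreservesWeightedLimits (Q : Weight V D) (U : EnrichedFunctor V B A) : Prop :=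
  ∀ ⦃S : EnrichedFunctor V D B⦄ ⦃L : B⦄ (c : WeightedCone Q S L), c.IsLimit → (c.map U).IsLimit

end WeightedLimits

/-! ### Enough cofibrantly-weighted limits -/

section Enough

variable (V : Type u) [Category.{v} V] [MonoidalCategory V]

/-- The unit `V`-category: a single object, with object of endomorphisms the unit `I`. -/
inductive UnitCat : Type
  | pt

instance : EnrichedCategory V UnitCat where
  Hom _ _ := 𝟙_ V
  id _ := 𝟙 _
  comp _ _ _ := (λ_ (𝟙_ V)).hom
  id_comp _ _ := by simp
  comp_id _ _ := by simp [unitors_equal]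
  assoc _ _ _ _ := by simp [unitors_equal]

variable [MonoidalClosed V]

/-- The `V`-functor from the unit `V`-category to `V` which selects the unit object `I`. -/
def unitWeight : EnrichedFunctor V UnitCat V where
  obj _ := 𝟙_ V
  map _ _ := eId V (𝟙_ V)
  map_id _ := Category.id_comp _
  map_comp _ _ _ := by
    apply MonoidalClosed.uncurry_injective
    refine Eq.trans ?_ (uncurry_tensorHom_comp (MonoidalClosed.id (𝟙_ V))
      (MonoidalClosed.id (𝟙_ V))).symm
    rw [MonoidalClosed.id_eq, MonoidalClosed.uncurry_curry]
    refine (MonoidalClosed.uncurry_natural_left _ (MonoidalClosed.id (𝟙_ V))).trans ?_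
    rw [MonoidalClosed.id_eq, MonoidalClosed.uncurry_curry]
    change 𝟙_ V ◁ (λ_ (𝟙_ V)).hom ≫ (ρ_ (𝟙_ V)).hom =
      (α_ (𝟙_ V) (𝟙_ V) (𝟙_ V)).inv ≫ (ρ_ (𝟙_ V)).hom ▷ 𝟙_ V ≫ (ρ_ (𝟙_ V)).hom
    rw [← triangle_assoc, Iso.inv_hom_id_assoc]

end Enough

section Enough

variable {V : Type u} [Category.{v} V] [MonoidalCategory V] [SymmetricCategory V]
  [MonoidalClosed V] [HasLimits V] [ModelCategory V]
variable {B : Type u₁} [EnrichedCategory V B] {A : Type u₂} [EnrichedCategory V A]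

/-- A cofibrant weight `Q` on `D` with a levelwise trivial fibration `Q ⟶ I P`, where
`P : D ⟶ 𝓘` is a `V`-functor to the unit `V`-category and `I P` is the composite
`D ⟶ 𝓘 ⟶ V`. -/
structure CofibrantReplacement {D : Type v} [EnrichedCategory V D]
    (P : EnrichedFunctor V D UnitCat) where
  /-- the weight -/
  Q : Weight V D
  /-- the projection -/
  q : WeightHom Q (P.comp V (unitWeight V))
  isCofibrantWeight : IsCofibrantWeight Q
  isTrivialFibration : q.IsTrivialFibration

variable (V) in
/-- A choice of a cofibrant weight as in `CofibrantReplacement` for each small `V`-category `D` over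
the unit `V`-category. -/
abbrev ReplacementChoice :=
  ∀ (D : Type v) [EnrichedCategory V D] (P : EnrichedFunctor V D UnitCat), CofibrantReplacement P

variable (B) in
/-- `B` has enough cofibrantly-weighted limits, as witnessed by the chosen weights `R`: it has all
limits weighted by the chosen weights. -/
def HasEnoughLimits (R : ReplacementChoice V) : Prop :=
  ∀ (D : Type v) [EnrichedCategory V D] (P : EnrichedFunctor V D UnitCat),
    HasWeightedLimits B (R D P).Q

/-- `U` preserves enough cofibrantly-weighted limits, namely those weighted by the chosen
weights `R`. -/
def PreservesEnoughLimits (R : ReplacementChoice V) (U : EnrichedFunctor V B A) : Prop :=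
  ∀ (D : Type v) [EnrichedCategory V D] (P : EnrichedFunctor V D UnitCat),
    PreservesWeightedLimits (R D P).Q U

end Enough

end WeakAFT

end

/-
Call two points of `B(x, y)` homotopic over `A(X, U y)` when some homotopy between them becomes
constant in `A(X, U y)`; this is a congruence on the ordinary comma category `X / U₀`. Consider the
full sub-`V`-category `D` of `X / U` on a small family of objects `x k`, and the cofibrant
replacement `q : Q ⟶ ΔI` of the constant weight on `D`. Since `U` preserves the `Q`-weighted limit
`ℓ` of the projection `D ⟶ B`, that limit lifts to `X / U₀`. As `I` is cofibrant, each component of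
`q` has a section, unique up to homotopy over `I`; these sections yield projections `π k : ℓ ⟶ x k`,
which are compatible with the morphisms of the family up to homotopy. For `ψ : x k ⟶ ℓ`, the
endomorphisms `π k ≫ ψ` and `1` of `ℓ` are both induced by endomorphisms of `Q` over `ΔI`. As `Q` is
cofibrant, these are all homotopic, so `π k ≫ ψ` is homotopic to `1`. In the homotopy category of
`X / U₀`, cones with this property suffice for Freyd's argument, which produces an initial object
from a small weakly initial family.

Powers make the initiality of `ℓ` internal: applying it to the lift to `X / U₀` of the power of `Y`
by `A(X, U Y)` gives a section of `B(ℓ, Y) ⟶ A(X, U Y)`, and applying it to the power of `Y` by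
`B(ℓ, Y)` gives the homotopy which makes that morphism shrinkable.
-/

universe w

noncomputable section

namespace WeakAFT

section Homotopy

variable {C : Type u} [Category.{v} C] [ModelCategory C]

/-- Two morphisms `a b : X ⟶ M` are homotopic over `g : M ⟶ N` if some left homotopy between them,
defined on a good cylinder of `X`, becomes constant after composition with `g`. -/
def HomotopicOver {X M N : C} (g : M ⟶ N) (a b : X ⟶ M) : Prop :=
  ∃ (P : Cylinder X) (_ : P.IsGood) (h : P.LeftHomotopy a b), h.h ≫ g = P.π ≫ a ≫ g

namespace HomotopicOver

variable {X M N : C} {g : M ⟶ N} {a b c : X ⟶ M}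

lemma comp_eq (h : HomotopicOver g a b) : a ≫ g = b ≫ g := by
  obtain ⟨P, _, h, hg⟩ := h
  rw [← h.h₁, Category.assoc, hg, P.i₁_π_assoc]

lemma symm (h : HomotopicOver g a b) : HomotopicOver g b a := by
  have hab := h.comp_eq
  obtain ⟨P, _, h, hg⟩ := h
  exact ⟨P.symm, inferInstance, h.symm, hg.trans (congrArg (P.π ≫ ·) hab)⟩

lemma trans [IsCofibrant X] (h : HomotopicOver g a b) (h' : HomotopicOver g b c) :
    HomotopicOver g a c := by
  have hab := h.comp_eq
  obtain ⟨P, _, h, hg⟩ := h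
  obtain ⟨P', _, h', hg'⟩ := h'
  refine ⟨P.trans P', inferInstance, h.trans h', pushout.hom_ext ?_ ?_⟩
  · exact (pushout.inl_desc_assoc _ _ _ _).trans
      (hg.trans (pushout.inl_desc_assoc _ _ _ _).symm)
  · exact (pushout.inr_desc_assoc _ _ _ _).trans
      ((hg'.trans (congrArg (P'.π ≫ ·) hab.symm)).trans (pushout.inr_desc_assoc _ _ _ _).symm)

lemma map (h : HomotopicOver g a b) {M' N' : C} {g' : M' ⟶ N'} (k : M ⟶ M') (m : N ⟶ N')
    (w : k ≫ g' = g ≫ m) : HomotopicOver g' (a ≫ k) (b ≫ k) := by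
  obtain ⟨P, hP, h, hg⟩ := h
  refine ⟨P, hP, h.postcomp k, ?_⟩
  rw [Precylinder.LeftHomotopy.postcomp_h, Category.assoc, Category.assoc, w, reassoc_of% hg]

lemma of_trivialFibration (hg : trivialFibrations C g) (w : a ≫ g = b ≫ g) :
    HomotopicOver g a b := by
  obtain ⟨P, _⟩ := Cylinder.exists_very_good X
  have : Fibration g := ⟨hg.1⟩
  have : WeakEquivalence g := ⟨hg.2⟩
  have sq : CommSq (coprod.desc a b) P.i g (P.π ≫ a ≫ g) := ⟨coprod.hom_ext
    (by rw [coprod.inl_desc_assoc, P.inl_i_assoc, P.i₀_π_assoc])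
    (by rw [coprod.inr_desc_assoc, P.inr_i_assoc, P.i₁_π_assoc, w])⟩
  refine ⟨P, inferInstance, ⟨sq.lift, ?_, ?_⟩, sq.fac_right⟩
  · rw [← P.inl_i, Category.assoc, sq.fac_left, coprod.inl_desc]
  · rw [← P.inr_i, Category.assoc, sq.fac_left, coprod.inr_desc]

variable (g) in
lemma refl (a : X ⟶ M) : HomotopicOver g a a := by
  obtain ⟨P, _⟩ := Cylinder.exists_very_good X
  exact ⟨P, inferInstance, .refl P a, Category.assoc _ _ _⟩

variable (X g) in
lemma equivalence [IsCofibrant X] : Equivalence (HomotopicOver (X := X) g) where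
  refl := refl g
  symm := symm
  trans := trans

end HomotopicOver

lemma exists_section_of_trivialFibration {X Y : C} [IsCofibrant Y] {g : X ⟶ Y}
    (hg : trivialFibrations C g) : ∃ s : Y ⟶ X, s ≫ g = 𝟙 Y := by
  have : Fibration g := ⟨hg.1⟩
  have : WeakEquivalence g := ⟨hg.2⟩
  have sq : CommSq (initial.to X) (initial.to Y) g (𝟙 Y) := ⟨by ext⟩
  exact ⟨sq.lift, sq.fac_right⟩

variable [MonoidalCategory C]

/-- A good cylinder of the unit object, as an interval. -/
def Interval.ofCylinder (P : Cylinder (𝟙_ C)) [P.IsGood] : Interval C where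
  J := P.I
  d := P.i₀
  c := P.i₁
  e := P.π
  d_e := P.i₀_π
  c_e := P.i₁_π
  cofibration_desc := (inferInstance : Cofibration P.i).mem
  weakEquivalence_e := P.weakEquivalence_π.mem

lemma shrinkable_of_homotopicOver [MonoidalClosed C] {X Y : C} {f : X ⟶ Y} {s : Y ⟶ X}
    (hs : s ≫ f = 𝟙 Y)
    (h : HomotopicOver ((ihom X).map f) (MonoidalClosed.curry' (f ≫ s))
      (MonoidalClosed.curry' (𝟙 X))) : shrinkable C f := by
  obtain ⟨P, _, h, hf⟩ := h
  refine ⟨s, hs, .ofCylinder P, h.h, h.h₀, h.h₁, hf.trans ?_⟩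
  rw [MonoidalClosed.curry'_ihom_map, Category.assoc, hs, Category.comp_id]
  rfl

end Homotopy

section Initial

variable {C : Type u} [Category.{v} C]

theorem hasInitial_of_weaklyInitial
    (hC : ∀ {K : Type w} (x : K → C), ∃ (ℓ : C) (π : ∀ k, ℓ ⟶ x k),
      (∀ k l (a : x k ⟶ x l), π k ≫ a = π l) ∧ ∀ k (ψ : x k ⟶ ℓ), π k ≫ ψ = 𝟙 ℓ)
    {K : Type w} (x : K → C) (hx : ∀ y, ∃ k, Nonempty (x k ⟶ y)) : HasInitial C := by
  obtain ⟨ℓ, π, -, π_comp⟩ := hC x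
  have weaklyInitial (y : C) : Nonempty (ℓ ⟶ y) := by
    obtain ⟨k, ⟨a⟩⟩ := hx y
    exact ⟨π k ≫ a⟩
  refine (IsInitial.ofUniqueHom (fun y => (weaklyInitial y).some) fun y b => ?_).hasInitial
  obtain ⟨e, ρ, ρ_comp, -⟩ := hC fun i : ULift.{w} Bool => cond i.down ℓ y
  obtain ⟨k, ⟨ψ⟩⟩ := hx e
  have h (a : ℓ ⟶ y) : a = π k ≫ ψ ≫ ρ ⟨false⟩ := calc
    a = (π k ≫ ψ ≫ ρ ⟨true⟩) ≫ a := by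
      rw [show π k ≫ ψ ≫ ρ ⟨true⟩ = 𝟙 ℓ from π_comp k (ψ ≫ ρ ⟨true⟩), Category.id_comp]
    _ = π k ≫ ψ ≫ ρ ⟨false⟩ := by rw [← ρ_comp ⟨true⟩ ⟨false⟩ a, Category.assoc, Category.assoc]
  exact (h b).trans (h _).symm

end Initial

section Precomp

variable {V : Type u} [Category.{v} V] [MonoidalCategory V]
variable {A : Type u₂} [EnrichedCategory V A]

lemma precomp_whiskerRight_eComp {X Y : A} (a : 𝟙_ V ⟶ (X ⟶[V] Y)) (Z W : A) :
    precomp a Z ▷ (Z ⟶[V] W) ≫ eComp V X Z W = eComp V Y Z W ≫ precomp a W := by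
  simp only [precomp, comp_whiskerRight, Category.assoc]
  rw [leftUnitor_inv_naturality_assoc, whisker_exchange_assoc, ← e_assoc]
  simp [e_assoc']

lemma precomp_eId (X Z : A) : precomp (eId V X) Z = 𝟙 _ := by
  simp [precomp]

lemma comp_precomp {X Y Z : A} (a : 𝟙_ V ⟶ (X ⟶[V] Y)) (b : 𝟙_ V ⟶ (Y ⟶[V] Z)) :
    b ≫ precomp a Z = (λ_ _).inv ≫ (a ⊗ₘ b) ≫ eComp V X Y Z := by
  rw [precomp, leftUnitor_inv_naturality_assoc, tensorHom_def'_assoc]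

lemma eId_precomp {X Y : A} (a : 𝟙_ V ⟶ (X ⟶[V] Y)) : eId V Y ≫ precomp a Y = a := by
  rw [precomp, leftUnitor_inv_naturality_assoc, whisker_exchange_assoc, unitors_inv_equal,
    ← rightUnitor_inv_naturality_assoc, e_comp_id, Category.comp_id]

lemma precomp_precomp {X Y Z : A} (a : 𝟙_ V ⟶ (X ⟶[V] Y)) (b : 𝟙_ V ⟶ (Y ⟶[V] Z)) (W : A) :
    precomp b W ≫ precomp a W = precomp (b ≫ precomp a Z) W := by
  conv_rhs => rw [precomp]
  rw [comp_whiskerRight_assoc, precomp_whiskerRight_eComp]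
  simp [precomp]

/-- Postcomposition `A(Z, X) ⟶ A(Z, Y)` with a morphism `a : I ⟶ A(X, Y)` of the underlying
category; the counterpart of `precomp`. -/
def postcomp {X Y : A} (a : 𝟙_ V ⟶ (X ⟶[V] Y)) (Z : A) : (Z ⟶[V] X) ⟶ (Z ⟶[V] Y) :=
  (ρ_ _).inv ≫ _ ◁ a ≫ eComp V Z X Y

lemma comp_postcomp {X Y Z : A} (f : 𝟙_ V ⟶ (Z ⟶[V] X)) (a : 𝟙_ V ⟶ (X ⟶[V] Y)) :
    f ≫ postcomp a Z = a ≫ precomp f Y := by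
  rw [precomp, postcomp, leftUnitor_inv_naturality_assoc, whisker_exchange_assoc,
    rightUnitor_inv_naturality_assoc, unitors_inv_equal]

variable {B : Type u₁} [EnrichedCategory V B] (U : EnrichedFunctor V B A)

/-- The morphism `B(L, Y) ⟶ A(U L, U Y) ⟶ A(X, U Y)` induced by `η : X ⟶ U L`, whose
shrinkability for all `Y` defines weak reflections. -/
def transposeMap {X : A} {L : B} (η : 𝟙_ V ⟶ (X ⟶[V] U.obj L)) (Y : B) :
    (L ⟶[V] Y) ⟶ (X ⟶[V] U.obj Y) :=
  U.map L Y ≫ precomp η (U.obj Y)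

lemma eComp_transposeMap {X : A} {L : B} (η : 𝟙_ V ⟶ (X ⟶[V] U.obj L)) (Y Z : B) :
    eComp V L Y Z ≫ transposeMap U η Z =
      transposeMap U η Y ▷ _ ≫ _ ◁ U.map Y Z ≫ eComp V X (U.obj Y) (U.obj Z) := by
  rw [transposeMap, U.map_comp_assoc, ← precomp_whiskerRight_eComp, tensorHom_def_assoc,
    transposeMap, comp_whiskerRight_assoc, whisker_exchange_assoc]

lemma precomp_transposeMap {X : A} {L P : B} (η : 𝟙_ V ⟶ (X ⟶[V] U.obj L))
    (a : 𝟙_ V ⟶ (L ⟶[V] P)) (Y : B) :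
    precomp a Y ≫ transposeMap U η Y = transposeMap U (a ≫ transposeMap U η P) Y := by
  conv_lhs => rw [precomp]
  simp only [Category.assoc]
  rw [eComp_transposeMap, ← comp_whiskerRight_assoc, ← whisker_exchange_assoc,
    ← leftUnitor_inv_naturality_assoc]
  rfl

lemma postcomp_transposeMap {X : A} {L Y Z : B} (η : 𝟙_ V ⟶ (X ⟶[V] U.obj L))
    (a : 𝟙_ V ⟶ (Y ⟶[V] Z)) :
    postcomp a L ≫ transposeMap U η Z = transposeMap U η Y ≫ postcomp (a ≫ U.map Y Z) X := by
  rw [postcomp, postcomp, Category.assoc, Category.assoc, eComp_transposeMap,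
    whisker_exchange_assoc, ← rightUnitor_inv_naturality_assoc,
    MonoidalCategory.whiskerLeft_comp_assoc]

lemma eId_transposeMap {X : A} {L : B} (η : 𝟙_ V ⟶ (X ⟶[V] U.obj L)) :
    eId V L ≫ transposeMap U η L = η := by
  rw [transposeMap, U.map_id_assoc, eId_precomp]

lemma whiskerRight_eComp_eq_transposeMap {X : A} {L : B} (η : 𝟙_ V ⟶ (X ⟶[V] U.obj L)) (Y : B) :
    η ▷ _ ≫ _ ◁ U.map L Y ≫ eComp V X (U.obj L) (U.obj Y) = (λ_ _).hom ≫ transposeMap U η Y := by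
  rw [transposeMap, precomp, ← leftUnitor_naturality_assoc, Iso.hom_inv_id_assoc,
    whisker_exchange_assoc]

end Precomp

section Powers

variable {V : Type u} [Category.{v} V] [MonoidalCategory V] [SymmetricCategory V]
  [MonoidalClosed V]
variable {A : Type u₂} [EnrichedCategory V A] {B : Type u₁} [EnrichedCategory V B]

lemma coneTranspose_transposeMap (U : EnrichedFunctor V B A) {X : A} {L P Y : B} {W : V}
    (η : 𝟙_ V ⟶ (X ⟶[V] U.obj L)) (ι : W ⟶ (P ⟶[V] Y)) :
    coneTranspose ι L ≫ (ihom W).map (transposeMap U η Y) =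
      transposeMap U η P ≫ coneTranspose (ι ≫ U.map P Y) X := by
  rw [coneTranspose, coneTranspose, ← MonoidalClosed.curry_natural_right,
    ← MonoidalClosed.curry_natural_left]
  congr 1
  simp only [Category.assoc]
  rw [eComp_transposeMap, BraidedCategory.braiding_naturality_right_assoc,
    MonoidalCategory.whiskerLeft_comp_assoc, whisker_exchange_assoc]

lemma comp_coneTranspose {P Y Z : B} {W : V} (a : 𝟙_ V ⟶ (Z ⟶[V] P)) (ι : W ⟶ (P ⟶[V] Y)) :
    a ≫ coneTranspose ι Z = MonoidalClosed.curry' (ι ≫ precomp a Y) := by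
  rw [coneTranspose, ← MonoidalClosed.curry_natural_left, MonoidalClosed.curry']
  congr 1
  rw [BraidedCategory.braiding_naturality_right_assoc, precomp, leftUnitor_inv_naturality_assoc,
    whisker_exchange_assoc, braiding_tensorUnit_right]
  simp

lemma IsPower.existsUnique_precomp {W : V} {P Y : B} {ι : W ⟶ (P ⟶[V] Y)} (hι : IsPower ι) {Z : B}
    (t : W ⟶ (Z ⟶[V] Y)) : ∃! a : 𝟙_ V ⟶ (Z ⟶[V] P), ι ≫ precomp a Y = t := by
  have := hι Z
  have h (a : 𝟙_ V ⟶ (Z ⟶[V] P)) :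
      ι ≫ precomp a Y = t ↔ a = MonoidalClosed.curry' t ≫ inv (coneTranspose ι Z) := by
    rw [IsIso.eq_comp_inv, comp_coneTranspose]
    exact ⟨congrArg _, fun h => MonoidalClosed.curry'_injective h⟩
  exact ⟨_, (h _).2 rfl, fun a ha => (h a).1 ha⟩

end Powers

section WeightHom

variable {V : Type u} [Category.{v} V] [MonoidalCategory V] [MonoidalClosed V]
variable {D : Type v} [EnrichedCategory V D]

attribute [ext] WeightHom

namespace WeightHom

/-- A constructor for `V`-natural transformations, with naturality stated in terms of the actions
`F d ⊗ D(d, d') ⟶ F d'`. -/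
def ofUncurry {F G : Weight V D} (app : ∀ d, F.obj d ⟶ G.obj d)
    (h : ∀ d d', MonoidalClosed.uncurry (F.hom d d') ≫ app d' =
      app d ▷ _ ≫ MonoidalClosed.uncurry (G.hom d d')) : WeightHom F G where
  app := app
  naturality d d' := by
    apply MonoidalClosed.uncurry_injective
    rw [MonoidalClosed.uncurry_natural_right, MonoidalClosed.uncurry_pre_app, h]

/-- The identity `V`-natural transformation. -/
def id (F : Weight V D) : WeightHom F F :=
  .ofUncurry (fun _ => 𝟙 _) (by simp)

/-- The (vertical) composite of `V`-natural transformations. -/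
def comp {F G H : Weight V D} (p : WeightHom F G) (q : WeightHom G H) : WeightHom F H :=
  .ofUncurry (fun d => p.app d ≫ q.app d) fun d d' => by
    rw [← Category.assoc, p.uncurry_naturality, Category.assoc, q.uncurry_naturality,
      comp_whiskerRight_assoc]

lemma comp_app {F G H : Weight V D} (p : WeightHom F G) (q : WeightHom G H) (d : D) :
    (p.comp q).app d = p.app d ≫ q.app d := rfl

lemma id_comp {F G : Weight V D} (p : WeightHom F G) : (id F).comp p = p := by
  ext d
  exact Category.id_comp _

lemma comp_id {F G : Weight V D} (p : WeightHom F G) : p.comp (id G) = p := by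
  ext d
  exact Category.comp_id _

lemma comp_assoc {F G H K : Weight V D} (p : WeightHom F G) (q : WeightHom G H)
    (r : WeightHom H K) : (p.comp q).comp r = p.comp (q.comp r) := by
  ext d
  exact Category.assoc _ _ _

end WeightHom

end WeightHom

section Yoneda

variable {V : Type u} [Category.{v} V] [MonoidalCategory V] [MonoidalClosed V]
variable {D : Type v} [EnrichedCategory V D]

lemma Weight.uncurry_hom_comp (F : Weight V D) (d d' d'' : D) :
    F.obj d ◁ eComp V d d' d'' ≫ MonoidalClosed.uncurry (F.hom d d'') =
      (α_ _ _ _).inv ≫ MonoidalClosed.uncurry (F.hom d d') ▷ _ ≫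
        MonoidalClosed.uncurry (F.hom d' d'') := by
  rw [← MonoidalClosed.uncurry_natural_left, ← uncurry_tensorHom_comp]
  exact congrArg MonoidalClosed.uncurry (F.map_comp d d' d'')

/-- The action `D(d, d') ⟶ F d'` of a weight `F` on a point of `F d`. -/
def Weight.act (F : Weight V D) {d : D} (p : 𝟙_ V ⟶ F.obj d) (d' : D) : (d ⟶[V] d') ⟶ F.obj d' :=
  (λ_ _).inv ≫ p ▷ _ ≫ MonoidalClosed.uncurry (F.hom d d')

lemma Weight.eComp_act (F : Weight V D) {d : D} (p : 𝟙_ V ⟶ F.obj d) (d' d'' : D) :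
    eComp V d d' d'' ≫ F.act p d'' =
      F.act p d' ▷ _ ≫ MonoidalClosed.uncurry (F.hom d' d'') := by
  rw [act, act, leftUnitor_inv_naturality_assoc, whisker_exchange_assoc, F.uncurry_hom_comp]
  simp

lemma Weight.act_app {F G : Weight V D} {d : D} (p : 𝟙_ V ⟶ F.obj d) (t : WeightHom F G) (d' : D) :
    F.act p d' ≫ t.app d' = G.act (p ≫ t.app d) d' := by
  rw [act, act, Category.assoc, Category.assoc, t.uncurry_naturality, comp_whiskerRight_assoc]

lemma uncurry_representable_hom (d d' d'' : D) :
    MonoidalClosed.uncurry (Weight.hom (representable V d) d' d'') = eComp V d d' d'' :=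
  MonoidalClosed.uncurry_curry _

/-- The Yoneda transformation `D(d, -) ⟶ F` corresponding to a point of `F d`. -/
def yoneda (F : Weight V D) {d : D} (p : 𝟙_ V ⟶ F.obj d) : WeightHom (representable V d) F :=
  .ofUncurry (F.act p) fun d' d'' =>
    (congrArg (· ≫ F.act p d'') (uncurry_representable_hom d d' d'')).trans (F.eComp_act p d' d'')

lemma yoneda_comp {F G : Weight V D} {d : D} (p : 𝟙_ V ⟶ F.obj d) (t : WeightHom F G) :
    (yoneda F p).comp t = yoneda G (p ≫ t.app d) := by
  ext d'
  exact Weight.act_app p t d'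

variable {A : Type u₂} [EnrichedCategory V A] {B : Type u₁} [EnrichedCategory V B]

/-- The transformation `B(L, S -) ⟶ B(Y, S -)` induced by a morphism `a : Y ⟶ L`. -/
def precompHom (S : EnrichedFunctor V D B) {Y L : B} (a : 𝟙_ V ⟶ (Y ⟶[V] L)) :
    WeightHom (S.comp V (representable V L)) (S.comp V (representable V Y)) :=
  .ofUncurry (fun d => precomp a (S.obj d)) fun d d' => by
    have h : ((L ⟶[V] S.obj d) ◁ S.map d d' ≫ eComp V L (S.obj d) (S.obj d')) ≫
        precomp a (S.obj d') =
        precomp a (S.obj d) ▷ _ ≫ (Y ⟶[V] S.obj d) ◁ S.map d d' ≫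
          eComp V Y (S.obj d) (S.obj d') := by
      rw [Category.assoc, ← precomp_whiskerRight_eComp, whisker_exchange_assoc]
    rw [uncurry_hom_representable, uncurry_hom_representable]
    exact h

/-- The transformation `B(L, S -) ⟶ A(X, U S -)` induced by a morphism `η : X ⟶ U L`. -/
def transposeHom (S : EnrichedFunctor V D B) (U : EnrichedFunctor V B A) {X : A} {L : B}
    (η : 𝟙_ V ⟶ (X ⟶[V] U.obj L)) :
    WeightHom (S.comp V (representable V L)) ((S.comp V U).comp V (representable V X)) :=
  .ofUncurry (fun d => transposeMap U η (S.obj d)) fun d d' => by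
    have h : ((L ⟶[V] S.obj d) ◁ S.map d d' ≫ eComp V L (S.obj d) (S.obj d')) ≫
        transposeMap U η (S.obj d') =
        transposeMap U η (S.obj d) ▷ _ ≫
          (X ⟶[V] U.obj (S.obj d)) ◁ (S.map d d' ≫ U.map (S.obj d) (S.obj d')) ≫
            eComp V X (U.obj (S.obj d)) (U.obj (S.obj d')) := by
      rw [Category.assoc, eComp_transposeMap, whisker_exchange_assoc,
        MonoidalCategory.whiskerLeft_comp_assoc]
    rw [uncurry_hom_representable, uncurry_hom_representable]
    exact h

lemma precompHom_comp_transposeHom (S : EnrichedFunctor V D B) (U : EnrichedFunctor V B A) {X : A}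
    {L Y : B} (a : 𝟙_ V ⟶ (Y ⟶[V] L)) (η : 𝟙_ V ⟶ (X ⟶[V] U.obj Y)) :
    (precompHom S a).comp (transposeHom S U η) =
      transposeHom S U (a ≫ transposeMap U η L) := by
  ext d
  exact precomp_transposeMap U η a (S.obj d)

lemma precompHom_comp_precompHom (S : EnrichedFunctor V D B) {X Y L : B}
    (b : 𝟙_ V ⟶ (Y ⟶[V] L)) (a : 𝟙_ V ⟶ (X ⟶[V] Y)) :
    (precompHom S b).comp (precompHom S a) = precompHom S (b ≫ precomp a L) := by
  ext d
  exact precomp_precomp a b (S.obj d)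

lemma precompHom_eId (S : EnrichedFunctor V D B) (L : B) :
    precompHom S (eId V L) = WeightHom.id _ := by
  ext d
  exact precomp_eId L (S.obj d)

lemma yoneda_comp_representable_app (S : EnrichedFunctor V D B) {L : B} {d : D}
    (p : 𝟙_ V ⟶ (L ⟶[V] S.obj d)) (d' : D) :
    (yoneda (S.comp V (representable V L)) p).app d' =
      S.map d d' ≫ precomp p (S.obj d') := by
  have h : S.map d d' ≫ precomp p (S.obj d') =
      (λ_ _).inv ≫ p ▷ _ ≫ (L ⟶[V] S.obj d) ◁ S.map d d' ≫ eComp V L (S.obj d) (S.obj d') := by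
    rw [precomp, leftUnitor_inv_naturality_assoc, whisker_exchange_assoc]
  rw [← uncurry_hom_representable] at h
  exact h.symm

lemma yoneda_eId_comp_precompHom (S : EnrichedFunctor V D B) {L : B} {d : D}
    (p : 𝟙_ V ⟶ (L ⟶[V] S.obj d)) :
    (yoneda (S.comp V (representable V (S.obj d))) (d := d) (eId V (S.obj d))).comp
      (precompHom S p) = yoneda (S.comp V (representable V L)) p :=
  (yoneda_comp _ _).trans (congrArg (yoneda _) (eId_precomp p))

lemma WeightedCone.map_comp_precompHom {Q : Weight V D} {S : EnrichedFunctor V D B} {L : B}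
    (c : WeightedCone Q S L) (U : EnrichedFunctor V B A) {X : A}
    (η : 𝟙_ V ⟶ (X ⟶[V] U.obj L)) :
    (c.map U).comp (precompHom (S.comp V U) η) = c.comp (transposeHom S U η) := by
  ext d
  exact Category.assoc _ _ _

end Yoneda

section NatObj

variable {V : Type u} [Category.{v} V] [MonoidalCategory V] [MonoidalClosed V]
  [SymmetricCategory V] [HasLimits V]
variable {D : Type v} [EnrichedCategory V D]

lemma natObjMap_π (Q : Weight V D) {F G : Weight V D} (p : WeightHom F G) (d : D) :
    natObjMap Q p ≫ natObjπ Q G d = natObjπ Q F d ≫ (ihom (Q.obj d)).map (p.app d) :=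
  natObjLift_π _ _ d

lemma natObjMap_comp (Q : Weight V D) {F G H : Weight V D} (p : WeightHom F G)
    (q : WeightHom G H) : natObjMap Q (p.comp q) = natObjMap Q p ≫ natObjMap Q q := by
  refine natObj_hom_ext fun d => ?_
  rw [Category.assoc, natObjMap_π, natObjMap_π, ← Category.assoc, natObjMap_π, Category.assoc,
    WeightHom.comp_app, Functor.map_comp]

/-- A `V`-natural transformation `F ⟶ G`, as a point of `[D, V](F, G)`. -/
def WeightHom.point {F G : Weight V D} (p : WeightHom F G) : 𝟙_ V ⟶ natObj F G :=
  natObjLift (fun d => MonoidalClosed.curry' (p.app d)) fun d d' => by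
    have h (d : D) : MonoidalClosed.uncurry (MonoidalClosed.curry' (p.app d)) =
        (ρ_ _).hom ≫ p.app d := MonoidalClosed.uncurry_curry _
    apply MonoidalClosed.uncurry_injective
    rw [uncurry_actRight, uncurry_actLeft, h, h, rightUnitor_naturality_assoc,
      p.uncurry_naturality, braiding_tensorUnit_right]
    simp

lemma WeightHom.point_π {F G : Weight V D} (p : WeightHom F G) (d : D) :
    p.point ≫ natObjπ F G d = MonoidalClosed.curry' (p.app d) :=
  natObjLift_π _ _ d

lemma WeightHom.point_injective {F G : Weight V D} :
    Function.Injective (WeightHom.point : WeightHom F G → _) := fun p q h => by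
  ext d
  apply MonoidalClosed.curry'_injective
  rw [← p.point_π, h, q.point_π]

lemma WeightHom.point_natObjMap {F G H : Weight V D} (p : WeightHom F G) (q : WeightHom G H) :
    p.point ≫ natObjMap F q = (p.comp q).point := by
  refine natObj_hom_ext fun d => ?_
  rw [Category.assoc, natObjMap_π, ← Category.assoc, p.point_π, MonoidalClosed.curry'_ihom_map,
    point_π, comp_app]

lemma IsCofibrantWeight.homotopicOver_point [ModelCategory V] {Q F G : Weight V D}
    (hQ : IsCofibrantWeight Q) {q : WeightHom F G} (hq : q.IsTrivialFibration)
    {t t' : WeightHom Q F} (h : t.comp q = t'.comp q) :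
    HomotopicOver (natObjMap Q q) t.point t'.point :=
  .of_trivialFibration (hQ q hq) (by rw [t.point_natObjMap, t'.point_natObjMap, h])

namespace WeightedCone

variable {A : Type u₂} [EnrichedCategory V A] {B : Type u₁} [EnrichedCategory V B]
  {Q : Weight V D} {S : EnrichedFunctor V D B} {L : B} (c : WeightedCone Q S L)

lemma comparison_π (X : B) (d : D) :
    c.comparison X ≫ natObjπ Q (S.comp V (representable V X)) d = coneTranspose (c.leg d) X :=
  natObjLift_π _ _ d

lemma comp_comparison {X : B} (a : 𝟙_ V ⟶ (X ⟶[V] L)) :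
    a ≫ c.comparison X = (c.comp (precompHom S a)).point := by
  refine natObj_hom_ext fun d => ?_
  rw [Category.assoc, comparison_π, WeightHom.point_π]
  exact comp_coneTranspose a (c.leg d)

lemma comparison_natObjMap_transposeHom (U : EnrichedFunctor V B A) {X : A} {Y : B}
    (η : 𝟙_ V ⟶ (X ⟶[V] U.obj Y)) :
    c.comparison Y ≫ natObjMap Q (transposeHom S U η) =
      transposeMap U η L ≫ (c.map U).comparison X := by
  refine natObj_hom_ext fun d => ?_
  rw [Category.assoc, Category.assoc, natObjMap_π, ← Category.assoc, comparison_π, comparison_π]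
  exact coneTranspose_transposeMap U η (c.leg d)

variable {c}

lemma IsLimit.exists_comp_precompHom (hc : c.IsLimit) {Y : B} (t : WeightedCone Q S Y) :
    ∃ a : 𝟙_ V ⟶ (Y ⟶[V] L), c.comp (precompHom S a) = t := by
  have := hc Y
  refine ⟨t.point ≫ inv (c.comparison Y), WeightHom.point_injective ?_⟩
  rw [← comp_comparison, Category.assoc, IsIso.inv_hom_id, Category.comp_id]

theorem IsLimit.homotopicOver [ModelCategory V] (hc : c.IsLimit) {U : EnrichedFunctor V B A}
    (hcU : (c.map U).IsLimit) (hQ : IsCofibrantWeight Q) {W : Weight V D} {q : WeightHom Q W}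
    (hq : q.IsTrivialFibration) {X : A} {β : WeightedCone W (S.comp V U) X}
    {η : 𝟙_ V ⟶ (X ⟶[V] U.obj L)} (hη : c.comp (transposeHom S U η) = q.comp β)
    {t t' : WeightHom Q Q} (htt' : t.comp q = t'.comp q) {a a' : 𝟙_ V ⟶ (L ⟶[V] L)}
    (ha : t.comp c = c.comp (precompHom S a)) (ha' : t'.comp c = c.comp (precompHom S a')) :
    HomotopicOver (transposeMap U η L) a a' := by
  have := hc L
  have := hcU X
  have w : (natObjMap Q c ≫ inv (c.comparison L)) ≫ transposeMap U η L =
      natObjMap Q q ≫ natObjMap Q β ≫ inv ((c.map U).comparison X) := by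
    rw [← cancel_mono ((c.map U).comparison X)]
    simp only [Category.assoc, IsIso.inv_hom_id, Category.comp_id]
    rw [← comparison_natObjMap_transposeHom, IsIso.inv_hom_id_assoc, ← natObjMap_comp, hη,
      natObjMap_comp]
  have e {t : WeightHom Q Q} {a : 𝟙_ V ⟶ (L ⟶[V] L)} (h : t.comp c = c.comp (precompHom S a)) :
      t.point ≫ natObjMap Q c ≫ inv (c.comparison L) = a := by
    rw [← Category.assoc, t.point_natObjMap, h, ← comp_comparison, Category.assoc,
      IsIso.hom_inv_id, Category.comp_id]
  simpa only [e ha, e ha'] using (hQ.homotopicOver_point hq htt').map _ _ w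

end WeightedCone

end NatObj

section CommaCategory

variable {V : Type u} [Category.{v} V] [MonoidalCategory V]
variable {A : Type u₂} [EnrichedCategory V A] {B : Type u₁} [EnrichedCategory V B]

lemma homTo_comp_eq_precomp {X Y Z : ForgetEnrichment V A} (f : X ⟶ Y) (g : Y ⟶ Z) :
    ForgetEnrichment.homTo V (f ≫ g) =
      ForgetEnrichment.homTo V g ≫ precomp (ForgetEnrichment.homTo V f) _ := by
  rw [ForgetEnrichment.homTo_comp, comp_precomp, Category.assoc]

lemma homTo_comp_forget_map (U : EnrichedFunctor V B A) {X : ForgetEnrichment V A}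
    {Y Z : ForgetEnrichment V B} (f : X ⟶ U.forget.obj Y) (g : Y ⟶ Z) :
    ForgetEnrichment.homTo V (f ≫ U.forget.map g) =
      ForgetEnrichment.homTo V g ≫ transposeMap U (ForgetEnrichment.homTo V f) _ :=
  (homTo_comp_eq_precomp f (U.forget.map g)).trans (Category.assoc _ _ _)

/-- The ordinary comma category `X / U₀`, where `U₀` is the ordinary functor underlying `U`. -/
abbrev CommaCategory (U : EnrichedFunctor V B A) (X : A) : Type _ :=
  StructuredArrow (ForgetEnrichment.of V X) U.forget

namespace CommaCategory

variable {U : EnrichedFunctor V B A} {X : A}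

/-- The object of `B` underlying an object of `X / U₀`. -/
def obj (x : CommaCategory U X) : B :=
  ForgetEnrichment.to V x.right

/-- The structure morphism `X ⟶ U x` of an object `x` of `X / U₀`, as a point of `A(X, U x)`. -/
def str (x : CommaCategory U X) : 𝟙_ V ⟶ (X ⟶[V] U.obj x.obj) :=
  ForgetEnrichment.homTo V x.hom

/-- The point of `B(x, y)` corresponding to a morphism `x ⟶ y` of `X / U₀`. -/
def point {x y : CommaCategory U X} (f : x ⟶ y) : 𝟙_ V ⟶ (x.obj ⟶[V] y.obj) :=
  ForgetEnrichment.homTo V f.right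

/-- The object of `X / U₀` with structure morphism `η`. -/
def mk {L : B} (η : 𝟙_ V ⟶ (X ⟶[V] U.obj L)) : CommaCategory U X :=
  StructuredArrow.mk (Y := ForgetEnrichment.of V L) (ForgetEnrichment.homOf V η)

lemma point_transposeMap {x y : CommaCategory U X} (f : x ⟶ y) :
    point f ≫ transposeMap U x.str y.obj = y.str :=
  (homTo_comp_forget_map U x.hom f.right).symm.trans
    (congrArg (ForgetEnrichment.homTo V) (StructuredArrow.w f))

lemma exists_point_eq {x y : CommaCategory U X} (a : 𝟙_ V ⟶ (x.obj ⟶[V] y.obj))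
    (h : a ≫ transposeMap U x.str y.obj = y.str) : ∃ f : x ⟶ y, point f = a :=
  ⟨StructuredArrow.homMk (ForgetEnrichment.homOf V a)
    ((homTo_comp_forget_map U x.hom (ForgetEnrichment.homOf V a)).trans h), rfl⟩

lemma precomp_point_transposeMap {x y : CommaCategory U X} (a : x ⟶ y) (Y : B) :
    precomp (point a) Y ≫ transposeMap U x.str Y = transposeMap U y.str Y := by
  rw [precomp_transposeMap, point_transposeMap]

lemma point_id (x : CommaCategory U X) : point (𝟙 x) = eId V x.obj :=
  ForgetEnrichment.homTo_id V x.right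

lemma point_comp {x y z : CommaCategory U X} (f : x ⟶ y) (g : y ⟶ z) :
    point (f ≫ g) = point g ≫ precomp (point f) z.obj :=
  homTo_comp_eq_precomp f.right g.right

variable [ModelCategory V]

variable (U X) in
/-- Two morphisms `x ⟶ y` of `X / U₀` are homotopic if they are so as points of `B(x, y)`, over
`A(X, U y)`. -/
def Homotopic : HomRel (CommaCategory U X) := fun x y f g =>
  HomotopicOver (transposeMap U x.str y.obj) (point f) (point g)

instance [IsCofibrant (𝟙_ V)] : Congruence (Homotopic U X) where
  equivalence := (HomotopicOver.equivalence _ _).comap point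
  comp_left {x y z} f g g' h := by
    rw [Homotopic, point_comp, point_comp]
    refine HomotopicOver.map h _ (𝟙 _) ?_
    rw [precomp_transposeMap, point_transposeMap, Category.comp_id]
  comp_right {x y z} f f' g h := by
    rw [Homotopic, point_comp, point_comp, ← comp_postcomp, ← comp_postcomp]
    exact HomotopicOver.map h _ _ (postcomp_transposeMap U x.str (point g))

end CommaCategory

end CommaCategory

section CommaFamily

variable {V : Type u} [Category.{v} V] [MonoidalCategory V]
variable {A : Type u₂} [EnrichedCategory V A] {B : Type u₁} [EnrichedCategory V B]

section

variable {K : Type w} {H : K → K → V} {F : K → B} (p : ∀ k l, H k l ⟶ (F k ⟶[V] F l))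
  {id : ∀ k, 𝟙_ V ⟶ H k k}
  {comp : ∀ k l m, H k l ⊗ H l m ⟶ H k m}

lemma id_comp_of_comp_eq_eComp (hid : ∀ k, id k ≫ p k k = eId V (F k))
    (hcomp : ∀ k l m, comp k l m ≫ p k m = (p k l ⊗ₘ p l m) ≫ eComp V (F k) (F l) (F m))
    (k l : K) :
    ((λ_ _).inv ≫ id k ▷ _ ≫ comp k k l) ≫ p k l = p k l := by
  rw [Category.assoc, Category.assoc, hcomp, tensorHom_def_assoc, ← comp_whiskerRight_assoc, hid,
    ← whisker_exchange_assoc, ← leftUnitor_inv_naturality_assoc, e_id_comp, Category.comp_id]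

lemma comp_id_of_comp_eq_eComp (hid : ∀ k, id k ≫ p k k = eId V (F k))
    (hcomp : ∀ k l m, comp k l m ≫ p k m = (p k l ⊗ₘ p l m) ≫ eComp V (F k) (F l) (F m))
    (k l : K) :
    ((ρ_ _).inv ≫ _ ◁ id l ≫ comp k l l) ≫ p k l = p k l := by
  rw [Category.assoc, Category.assoc, hcomp, tensorHom_def'_assoc,
    ← MonoidalCategory.whiskerLeft_comp_assoc, hid, whisker_exchange_assoc,
    ← rightUnitor_inv_naturality_assoc, e_comp_id, Category.comp_id]

lemma assoc_of_comp_eq_eComp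
    (hcomp : ∀ k l m, comp k l m ≫ p k m = (p k l ⊗ₘ p l m) ≫ eComp V (F k) (F l) (F m))
    (k l m n : K) :
    ((α_ _ _ _).inv ≫ comp k l m ▷ _ ≫ comp k m n) ≫ p k n =
      (_ ◁ comp l m n ≫ comp k l n) ≫ p k n := by
  have h : (comp k l m ▷ _ ≫ comp k m n) ≫ p k n =
      ((p k l ⊗ₘ p l m) ⊗ₘ p m n) ≫ eComp V (F k) (F l) (F m) ▷ _ ≫ eComp V _ _ _ := by
    rw [Category.assoc, hcomp, ← tensorHom_id, tensorHom_comp_tensorHom_assoc, hcomp,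
      ← tensorHom_id, tensorHom_comp_tensorHom_assoc, Category.id_comp, Category.comp_id]
  have h' : (_ ◁ comp l m n ≫ comp k l n) ≫ p k n =
      (p k l ⊗ₘ p l m ⊗ₘ p m n) ≫ _ ◁ eComp V (F l) (F m) (F n) ≫ eComp V _ _ _ := by
    rw [Category.assoc, hcomp, ← id_tensorHom, tensorHom_comp_tensorHom_assoc, hcomp,
      ← id_tensorHom, tensorHom_comp_tensorHom_assoc, Category.id_comp, Category.comp_id]
  rw [Category.assoc, h, h', ← associator_inv_naturality_assoc, e_assoc]

end

/-- The `V`-category structure on a type `K` with hom-objects `H k l`, for given identities and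
composition which are compatible with those of two `V`-categories `B` and `C`, along jointly monic
families of morphisms from `H` to the hom-objects of `B` and `C`. -/
abbrev enrichedCategoryOfJointlyMono {K : Type w} (H : K → K → V) {F : K → B}
    (p : ∀ k l, H k l ⟶ (F k ⟶[V] F l)) {C : Type*} [EnrichedCategory V C] {G : K → C}
    (q : ∀ k l, H k l ⟶ (G k ⟶[V] G l))
    (hom_ext : ∀ {T : V} {k l} {f g : T ⟶ H k l}, f ≫ p k l = g ≫ p k l →
      f ≫ q k l = g ≫ q k l → f = g)
    (id : ∀ k, 𝟙_ V ⟶ H k k) (id_p : ∀ k, id k ≫ p k k = eId V (F k))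
    (id_q : ∀ k, id k ≫ q k k = eId V (G k))
    (comp : ∀ k l m, H k l ⊗ H l m ⟶ H k m)
    (comp_p : ∀ k l m, comp k l m ≫ p k m = (p k l ⊗ₘ p l m) ≫ eComp V (F k) (F l) (F m))
    (comp_q : ∀ k l m, comp k l m ≫ q k m = (q k l ⊗ₘ q l m) ≫ eComp V (G k) (G l) (G m)) :
    EnrichedCategory V K where
  Hom := H
  id := id
  comp := comp
  id_comp k l := hom_ext
    ((id_comp_of_comp_eq_eComp p id_p comp_p k l).trans (Category.id_comp _).symm)
    ((id_comp_of_comp_eq_eComp q id_q comp_q k l).trans (Category.id_comp _).symm)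
  comp_id k l := hom_ext
    ((comp_id_of_comp_eq_eComp p id_p comp_p k l).trans (Category.id_comp _).symm)
    ((comp_id_of_comp_eq_eComp q id_q comp_q k l).trans (Category.id_comp _).symm)
  assoc k l m n := hom_ext (assoc_of_comp_eq_eComp p comp_p k l m n)
    (assoc_of_comp_eq_eComp q comp_q k l m n)

variable {U : EnrichedFunctor V B A} {X : A} {K : Type w} (x : K → CommaCategory U X)

lemma tensorHom_eComp_transposeMap {L M N : B} {η : 𝟙_ V ⟶ (X ⟶[V] U.obj L)}
    {θ : 𝟙_ V ⟶ (X ⟶[V] U.obj M)} {κ : 𝟙_ V ⟶ (X ⟶[V] U.obj N)} {S T : V}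
    {f : S ⟶ (L ⟶[V] M)} {r : S ⟶ 𝟙_ V} (hf : f ≫ transposeMap U η M = r ≫ θ)
    {g : T ⟶ (M ⟶[V] N)} {s : T ⟶ 𝟙_ V} (hg : g ≫ transposeMap U θ N = s ≫ κ) :
    ((f ⊗ₘ g) ≫ eComp V L M N) ≫ transposeMap U η N =
      ((r ⊗ₘ s) ≫ (λ_ (𝟙_ V)).hom) ≫ κ := by
  have h : (f ⊗ₘ g) ≫ eComp V L M N ≫ transposeMap U η N =
      r ▷ _ ≫ _ ◁ g ≫ θ ▷ _ ≫ _ ◁ U.map M N ≫ eComp V X (U.obj M) (U.obj N) := by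
    rw [eComp_transposeMap, tensorHom_def'_assoc, ← comp_whiskerRight_assoc, hf,
      comp_whiskerRight_assoc, whisker_exchange_assoc, whisker_exchange_assoc]
  rw [Category.assoc, h, whiskerRight_eComp_eq_transposeMap, leftUnitor_naturality_assoc, hg,
    MonoidalCategory.tensorHom_def]
  simp

/-- The index type of a family of objects of `X / U₀`, regarded as the full sub-`V`-category of the
comma `V`-category `X / U` on that family. -/
def CommaFamily (_ : K → CommaCategory U X) : Type w := K

namespace CommaFamily

variable [HasPullbacks V]

instance : EnrichedCategory V (CommaFamily x) :=
  enrichedCategoryOfJointlyMono (K := K)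
    (fun k l => pullback (transposeMap U (x k).str (x l).obj) (x l).str)
    (fun _ _ => pullback.fst _ _) (G := fun _ => UnitCat.pt) (fun _ _ => pullback.snd _ _)
    pullback.hom_ext
    (fun k => pullback.lift (eId V (x k).obj) (eId V UnitCat.pt)
      ((eId_transposeMap U (x k).str).trans (Category.id_comp _).symm))
    (fun _ => pullback.lift_fst _ _ _) (fun _ => pullback.lift_snd _ _ _)
    (fun k l m => pullback.lift
      ((pullback.fst _ _ ⊗ₘ pullback.fst _ _) ≫ eComp V (x k).obj (x l).obj (x m).obj)
      ((pullback.snd _ _ ⊗ₘ pullback.snd _ _) ≫ eComp V UnitCat.pt UnitCat.pt UnitCat.pt)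
      (tensorHom_eComp_transposeMap pullback.condition pullback.condition))
    (fun _ _ _ => pullback.lift_fst _ _ _) (fun _ _ _ => pullback.lift_snd _ _ _)

/-- The projection to `B`. -/
def toBase : EnrichedFunctor V (CommaFamily x) B where
  obj k := (x k).obj
  map _ _ := pullback.fst _ _
  map_id _ := pullback.lift_fst _ _ _
  map_comp _ _ _ := pullback.lift_fst _ _ _

/-- The projection to the unit `V`-category. -/
def toUnit : EnrichedFunctor V (CommaFamily x) UnitCat where
  obj _ := .pt
  map _ _ := pullback.snd _ _
  map_id _ := pullback.lift_snd _ _ _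
  map_comp _ _ _ := pullback.lift_snd _ _ _

variable {x}

/-- The component at the hom-objects of the projection `toUnit` to the unit `V`-category. -/
def aug (k l : CommaFamily x) : (k ⟶[V] l) ⟶ 𝟙_ V :=
  (toUnit x).map k l

/-- The structure morphism of an object of the family. -/
def str (k : CommaFamily x) : 𝟙_ V ⟶ (X ⟶[V] U.obj ((toBase x).obj k)) :=
  CommaCategory.str (x k)

lemma toBase_map_transposeMap (k l : CommaFamily x) :
    (toBase x).map k l ≫ transposeMap U k.str ((toBase x).obj l) = aug k l ≫ l.str :=
  pullback.condition

lemma eComp_aug (k l m : CommaFamily x) :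
    eComp V k l m ≫ aug k m = (aug k l ⊗ₘ aug l m) ≫ (λ_ (𝟙_ V)).hom :=
  (toUnit x).map_comp k l m

lemma exists_lift {k l : CommaFamily x} {T : V}
    {f : T ⟶ ((toBase x).obj k ⟶[V] (toBase x).obj l)} {g : T ⟶ 𝟙_ V}
    (w : f ≫ transposeMap U k.str ((toBase x).obj l) = g ≫ l.str) :
    ∃ h : T ⟶ (k ⟶[V] l), h ≫ (toBase x).map k l = f ∧ h ≫ aug k l = g :=
  ⟨pullback.lift f g w, pullback.lift_fst _ _ _, pullback.lift_snd _ _ _⟩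

lemma hom_ext {k l : CommaFamily x} {T : V} {f g : T ⟶ (k ⟶[V] l)}
    (h₁ : f ≫ (toBase x).map k l = g ≫ (toBase x).map k l) (h₂ : f ≫ aug k l = g ≫ aug k l) :
    f = g :=
  pullback.hom_ext h₁ h₂

end CommaFamily

end CommaFamily

section ConstantWeight

variable {V : Type u} [Category.{v} V] [MonoidalCategory V] [MonoidalClosed V] [HasPullbacks V]
variable {A : Type u₂} [EnrichedCategory V A] {B : Type u₁} [EnrichedCategory V B]
  {U : EnrichedFunctor V B A} {X : A} {K : Type v} {x : K → CommaCategory U X}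

namespace CommaFamily

lemma uncurry_hom_unitWeight (k l : CommaFamily x) :
    MonoidalClosed.uncurry (Weight.hom ((toUnit x).comp V (unitWeight V)) k l) =
      𝟙_ V ◁ aug k l ≫ (λ_ (𝟙_ V)).hom := by
  refine (MonoidalClosed.uncurry_natural_left (aug k l) (MonoidalClosed.id (𝟙_ V))).trans ?_
  rw [MonoidalClosed.id_eq, MonoidalClosed.uncurry_curry, unitors_equal]

lemma yoneda_unitWeight_app (k l : CommaFamily x) :
    (yoneda ((toUnit x).comp V (unitWeight V)) (d := k) (𝟙 (𝟙_ V))).app l = aug k l := by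
  have h : (λ_ _).inv ≫ 𝟙 (𝟙_ V) ▷ (k ⟶[V] l) ≫ 𝟙_ V ◁ aug k l ≫ (λ_ (𝟙_ V)).hom = aug k l := by
    simp
  rw [← uncurry_hom_unitWeight] at h
  exact h

variable (x) in
/-- The structure morphisms `X ⟶ U x`, as a cone of shape `CommaFamily x` with constant weight. -/
def structureCone :
    WeightedCone ((toUnit x).comp V (unitWeight V)) ((toBase x).comp V U) X :=
  .ofUncurry (fun k => k.str) fun k l => by
    have h : (𝟙_ V ◁ aug k l ≫ (λ_ (𝟙_ V)).hom) ≫ l.str =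
        k.str ▷ (k ⟶[V] l) ≫ _ ◁ ((toBase x).map k l ≫ U.map _ _) ≫ eComp V X _ _ := by
      rw [leftUnitor_naturality, Category.assoc, ← toBase_map_transposeMap,
        MonoidalCategory.whiskerLeft_comp_assoc, ← whisker_exchange_assoc,
        whiskerRight_eComp_eq_transposeMap, leftUnitor_naturality_assoc]
    rw [← uncurry_hom_unitWeight] at h
    exact h.trans (congrArg (k.str ▷ _ ≫ ·)
      (uncurry_hom_representable ((toBase x).comp V U) X k l).symm)

lemma yoneda_eId_app (k l : CommaFamily x) :
    (yoneda ((toBase x).comp V (representable V ((toBase x).obj k))) (d := k)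
      (eId V ((toBase x).obj k))).app l = (toBase x).map k l := by
  rw [yoneda_comp_representable_app, precomp_eId, Category.comp_id]

lemma exists_weightHom_representable {k : CommaFamily x} {F : Weight V (CommaFamily x)}
    {α : WeightedCone F (toBase x) ((toBase x).obj k)}
    {β : WeightHom F ((toUnit x).comp V (unitWeight V))}
    (w : α.comp (transposeHom (toBase x) U k.str) = β.comp (structureCone x)) :
    ∃ s : WeightHom F (representable V k),
      s.comp (yoneda _ (eId V ((toBase x).obj k))) = α ∧
        s.comp (yoneda _ (𝟙 (𝟙_ V))) = β := by
  choose s hα hβ using fun l => exists_lift (congrArg (WeightHom.app · l) w)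
  have hs (l m : CommaFamily x) : MonoidalClosed.uncurry (F.hom l m) ≫ s m =
      s l ▷ (l ⟶[V] m) ≫ eComp V k l m := by
    refine hom_ext ?_ ?_
    · rw [Category.assoc, Category.assoc, hα, (toBase x).map_comp, tensorHom_def_assoc,
        ← comp_whiskerRight_assoc, hα]
      exact α.uncurry_naturality l m
    · rw [Category.assoc, Category.assoc, hβ, eComp_aug, tensorHom_def_assoc,
        ← comp_whiskerRight_assoc, hβ]
      exact (β.uncurry_naturality l m).trans
        (congrArg (β.app l ▷ _ ≫ ·) (uncurry_hom_unitWeight l m))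
  refine ⟨.ofUncurry s fun l m => (hs l m).trans
    (congrArg (s l ▷ _ ≫ ·) (uncurry_representable_hom k l m).symm), ?_, ?_⟩
  · ext l
    rw [WeightHom.comp_app, yoneda_eId_app]
    exact hα l
  · ext l
    rw [WeightHom.comp_app, yoneda_unitWeight_app]
    exact hβ l

variable {Q : Weight V (CommaFamily x)} {q : WeightHom Q ((toUnit x).comp V (unitWeight V))}
  {k : CommaFamily x} {p : 𝟙_ V ⟶ Q.obj k}

lemma yoneda_comp_eq_of_section (hp : p ≫ q.app k = 𝟙 (𝟙_ V)) :
    (yoneda Q p).comp q = yoneda ((toUnit x).comp V (unitWeight V)) (d := k) (𝟙 (𝟙_ V)) := by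
  rw [yoneda_comp]
  exact congrArg _ hp

variable {L : B} {c : WeightedCone Q (toBase x) L} {η : 𝟙_ V ⟶ (X ⟶[V] U.obj L)}

lemma comp_leg_transposeMap
    (hη : c.comp (transposeHom (toBase x) U η) = q.comp (structureCone x))
    (hp : p ≫ q.app k = 𝟙 (𝟙_ V)) : (p ≫ c.leg k) ≫ transposeMap U η _ = k.str := by
  have h : c.leg k ≫ transposeMap U η _ = q.app k ≫ k.str := congrArg (WeightHom.app · k) hη
  have hp' : (p ≫ q.app k) ≫ k.str = k.str :=
    (congrArg (· ≫ k.str) hp).trans (Category.id_comp _)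
  rw [Category.assoc, h]
  exact (Category.assoc _ _ _).symm.trans hp'

end CommaFamily

end ConstantWeight

section HomotopyLimit

variable {V : Type u} [Category.{v} V] [MonoidalCategory V] [MonoidalClosed V] [ModelCategory V]
variable {A : Type u₂} [EnrichedCategory V A] {B : Type u₁} [EnrichedCategory V B]
  {U : EnrichedFunctor V B A} {X : A} {K : Type v} {x : K → CommaCategory U X}

namespace CommaFamily

variable {Q : Weight V (CommaFamily x)} {q : WeightHom Q ((toUnit x).comp V (unitWeight V))}
  {k : CommaFamily x} {p : 𝟙_ V ⟶ Q.obj k}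
  {L : B} {c : WeightedCone Q (toBase x) L} {η : 𝟙_ V ⟶ (X ⟶[V] U.obj L)}

lemma homotopicOver_of_parallel (hq : q.IsTrivialFibration)
    (hη : c.comp (transposeHom (toBase x) U η) = q.comp (structureCone x))
    (hp : p ≫ q.app k = 𝟙 (𝟙_ V)) {l : CommaFamily x} {p' : 𝟙_ V ⟶ Q.obj l}
    (hp' : p' ≫ q.app l = 𝟙 (𝟙_ V)) {a : 𝟙_ V ⟶ ((toBase x).obj k ⟶[V] (toBase x).obj l)}
    (ha : a ≫ transposeMap U k.str _ = l.str) :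
    HomotopicOver (transposeMap U η ((toBase x).obj l)) (a ≫ precomp (p ≫ c.leg k) _)
      (p' ≫ c.leg l) := by
  obtain ⟨a, rfl, ha'⟩ := exists_lift (g := 𝟙 _) (ha.trans (Category.id_comp _).symm)
  have hpq : Q.act p l ≫ q.app l = aug k l :=
    (congrArg (WeightHom.app · l) (yoneda_comp_eq_of_section hp)).trans (yoneda_unitWeight_app k l)
  have hpc : Q.act p l ≫ c.leg l = (toBase x).map k l ≫ precomp (p ≫ c.leg k) _ :=
    (Weight.act_app p c l).trans (yoneda_comp_representable_app (toBase x) (p ≫ c.leg k) l)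
  have h : HomotopicOver (q.app l) (a ≫ Q.act p l) p' := .of_trivialFibration (hq l) <| by
    rw [Category.assoc, hpq, hp']
    exact ha'
  simpa only [Category.assoc, hpc] using
    h.map (g' := transposeMap U η _) (c.leg l) l.str (congrArg (WeightHom.app · l) hη)

variable [SymmetricCategory V] [HasLimits V]

lemma homotopicOver_eId (hc : c.IsLimit) (hcU : (c.map U).IsLimit) (hQ : IsCofibrantWeight Q)
    (hq : q.IsTrivialFibration)
    (hη : c.comp (transposeHom (toBase x) U η) = q.comp (structureCone x))
    (hp : p ≫ q.app k = 𝟙 (𝟙_ V)) {ψ : 𝟙_ V ⟶ ((toBase x).obj k ⟶[V] L)}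
    (hψ : ψ ≫ transposeMap U k.str L = η) :
    HomotopicOver (transposeMap U η L) (ψ ≫ precomp (p ≫ c.leg k) L) (eId V L) := by
  obtain ⟨s, hsc, hsq⟩ := exists_weightHom_representable (k := k)
    (α := c.comp (precompHom (toBase x) ψ)) (β := q) (by
      rw [WeightHom.comp_assoc, precompHom_comp_transposeHom, hψ, hη])
  have hpc : (yoneda Q p).comp c =
      (yoneda _ (eId V ((toBase x).obj k))).comp (precompHom (toBase x) (p ≫ c.leg k)) :=
    (yoneda_comp p c).trans (yoneda_eId_comp_precompHom (toBase x) (p ≫ c.leg k)).symm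
  refine hc.homotopicOver hcU hQ hq hη (t := s.comp (yoneda Q p)) (t' := .id Q) ?_ ?_ ?_
  · rw [WeightHom.comp_assoc, yoneda_comp_eq_of_section hp, hsq, WeightHom.id_comp]
  · rw [WeightHom.comp_assoc, hpc, ← WeightHom.comp_assoc, hsc, WeightHom.comp_assoc,
      precompHom_comp_precompHom]
  · rw [WeightHom.id_comp, precompHom_eId, WeightHom.comp_id]

end CommaFamily

open CommaCategory CommaFamily in
variable (x) in
theorem exists_homotopyLimit [SymmetricCategory V] [HasLimits V] [IsCofibrant (𝟙_ V)]
    {R : ReplacementChoice V} (hB : HasEnoughLimits B R) (hU : PreservesEnoughLimits R U) :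
    ∃ (ℓ : CommaCategory U X) (π : ∀ k, ℓ ⟶ x k),
      (∀ k l (a : x k ⟶ x l), Homotopic U X (π k ≫ a) (π l)) ∧
        ∀ k (ψ : x k ⟶ ℓ), Homotopic U X (π k ≫ ψ) (𝟙 ℓ) := by
  have hQ := (R (CommaFamily x) (toUnit x)).isCofibrantWeight
  have hq := (R (CommaFamily x) (toUnit x)).isTrivialFibration
  obtain ⟨L, c, hc⟩ := hB (CommaFamily x) (toUnit x) (toBase x)
  have hcU := hU (CommaFamily x) (toUnit x) c hc
  obtain ⟨η, hη⟩ := hcU.exists_comp_precompHom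
    ((R (CommaFamily x) (toUnit x)).q.comp (structureCone x))
  rw [WeightedCone.map_comp_precompHom] at hη
  choose p hp using fun k => exists_section_of_trivialFibration (Y := 𝟙_ V) (hq k)
  let ℓ : CommaCategory U X := .mk η
  choose π hπ using fun k : K =>
    exists_point_eq (x := ℓ) (y := x k) (p k ≫ c.leg k) (comp_leg_transposeMap (k := k) hη (hp k))
  refine ⟨ℓ, π, fun k l a => ?_, fun k ψ => ?_⟩
  · rw [Homotopic, point_comp, hπ, hπ]
    exact homotopicOver_of_parallel (k := k) hq hη (hp k) (hp l) (point_transposeMap a)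
  · rw [Homotopic, point_comp, hπ, point_id]
    exact homotopicOver_eId (k := k) hc hcU hQ hq hη (hp k) (point_transposeMap ψ)

end HomotopyLimit

section HomotopyInitial

variable {V : Type u} [Category.{v} V] [MonoidalCategory V] [SymmetricCategory V]
  [MonoidalClosed V]
variable {A : Type u₂} [EnrichedCategory V A] {B : Type u₁} [EnrichedCategory V B]
  {U : EnrichedFunctor V B A} {X : A}

namespace CommaCategory

lemma exists_power (hB : HasPowers V B) (hU : PreservesPowers U) {W : V} {Y : B}
    (f : W ⟶ (X ⟶[V] U.obj Y)) :
    ∃ (y : CommaCategory U X) (ι : W ⟶ (y.obj ⟶[V] Y)), ι ≫ transposeMap U y.str Y = f ∧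
      ∀ (x : CommaCategory U X) (t : W ⟶ (x.obj ⟶[V] Y)), t ≫ transposeMap U x.str Y = f →
        ∃ a : x ⟶ y, ι ≫ precomp (point a) Y = t := by
  obtain ⟨P, ι, hι⟩ := hB W Y
  obtain ⟨η, hη, η_unique⟩ := (hU ι hι).existsUnique_precomp f
  refine ⟨mk η, ι, (Category.assoc _ _ _).symm.trans hη, fun x t ht => ?_⟩
  obtain ⟨a, rfl, -⟩ := hι.existsUnique_precomp t
  have a_str : a ≫ transposeMap U x.str P = η := by
    refine η_unique _ ((Category.assoc _ _ _).trans ?_)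
    change ι ≫ transposeMap U (a ≫ transposeMap U x.str P) Y = f
    rw [← precomp_transposeMap, ← Category.assoc, ht]
  obtain ⟨a, rfl⟩ := exists_point_eq (x := x) (y := mk η) a a_str
  exact ⟨a, rfl⟩

variable [ModelCategory V]

theorem hasInitial_quotient_homotopic [HasLimits V] [IsCofibrant (𝟙_ V)]
    {R : ReplacementChoice V} (hB : HasEnoughLimits B R) (hU : PreservesEnoughLimits R U)
    {K : Type v} (x : K → CommaCategory U X) (hx : ∀ y, ∃ k, Nonempty (x k ⟶ y)) :
    HasInitial (Quotient (Homotopic U X)) := by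
  let F := Quotient.functor (Homotopic U X)
  refine hasInitial_of_weaklyInitial (fun {K} z => ?_) (fun k => F.obj (x k)) fun y => ?_
  · obtain ⟨ℓ, π, π_comp, comp_π⟩ := exists_homotopyLimit (fun k => (z k).as) hB hU
    refine ⟨F.obj ℓ, fun k => F.map (π k), fun k l a => ?_, fun k ψ => ?_⟩
    · obtain ⟨a, rfl⟩ := F.map_surjective (X := (z k).as) (Y := (z l).as) a
      exact (F.map_comp _ _).symm.trans (CategoryTheory.Quotient.sound _ (π_comp k l a))
    · obtain ⟨ψ, rfl⟩ := F.map_surjective (X := (z k).as) ψ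
      exact (F.map_comp _ _).symm.trans (CategoryTheory.Quotient.sound _ (comp_π k ψ))
  · obtain ⟨k, ⟨a⟩⟩ := hx y.as
    exact ⟨k, ⟨F.map a⟩⟩

lemma Homotopic.homotopicOver_curry {x y : CommaCategory U X} {a b : x ⟶ y}
    (h : Homotopic U X a b) {W : V} {Y : B} (ι : W ⟶ (y.obj ⟶[V] Y)) :
    HomotopicOver ((ihom W).map (transposeMap U x.str Y))
      (MonoidalClosed.curry' (ι ≫ precomp (point a) Y))
      (MonoidalClosed.curry' (ι ≫ precomp (point b) Y)) := by
  rw [← comp_coneTranspose, ← comp_coneTranspose]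
  exact HomotopicOver.map h _ _ (coneTranspose_transposeMap U x.str ι)

theorem isWeakReflection_of_isInitial [IsCofibrant (𝟙_ V)] {ℓ : CommaCategory U X}
    (hℓ : IsInitial ((Quotient.functor (Homotopic U X)).obj ℓ)) (hB : HasPowers V B)
    (hU : PreservesPowers U) : IsWeakReflection (shrinkable V) U ℓ.str := by
  intro Y
  obtain ⟨s, hs⟩ : ∃ s, s ≫ transposeMap U ℓ.str Y = 𝟙 _ := by
    obtain ⟨y, ι, hι, -⟩ := exists_power hB hU (𝟙 (X ⟶[V] U.obj Y))
    obtain ⟨a, -⟩ := (Quotient.functor _).map_surjective (hℓ.to ((Quotient.functor _).obj y))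
    exact ⟨ι ≫ precomp (point a) Y, by rw [Category.assoc, precomp_point_transposeMap, hι]⟩
  obtain ⟨y, ι, -, ex⟩ := exists_power hB hU (transposeMap U ℓ.str Y)
  obtain ⟨a, ha⟩ := ex ℓ (transposeMap U ℓ.str Y ≫ s)
    (by rw [Category.assoc, hs, Category.comp_id])
  obtain ⟨b, hb⟩ := ex ℓ (𝟙 _) (Category.id_comp _)
  have hab : Homotopic U X a b := (Quotient.functor_map_eq_iff _ _ _).1 (hℓ.hom_ext _ _)
  have h := hab.homotopicOver_curry ι
  rw [ha, hb] at h
  exact shrinkable_of_homotopicOver hs h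

end CommaCategory

end HomotopyInitial

section SolutionSet

variable {V : Type u} [Category.{v} V] [MonoidalCategory V]
variable {A : Type u₂} [EnrichedCategory V A] {B : Type u₁} [EnrichedCategory V B]
  {U : EnrichedFunctor V B A}

theorem HasWeakLeftAdjoint.solutionSetCondition {E : MorphismProperty V}
    (hE : ∀ ⦃Y Z : V⦄ (f : Y ⟶ Z), E f → ∃ s, s ≫ f = 𝟙 Z) (hU : HasWeakLeftAdjoint E U) :
    SolutionSetCondition.{w} U.forget := by
  intro X
  obtain ⟨L, η, hη⟩ := hU (ForgetEnrichment.to V X)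
  refine ⟨PUnit, fun _ => ForgetEnrichment.of V L, fun _ => ForgetEnrichment.homOf V η,
    fun Y f => ⟨.unit, ?_⟩⟩
  obtain ⟨s, hs⟩ := hE _ (hη (ForgetEnrichment.to V Y))
  obtain ⟨g, -⟩ := CommaCategory.exists_point_eq (U := U) (x := .mk η) (y := StructuredArrow.mk f)
    (ForgetEnrichment.homTo V f ≫ s)
    ((Category.assoc _ _ _).trans ((congrArg _ hs).trans (Category.comp_id _)))
  exact ⟨g.right, StructuredArrow.w g⟩

end SolutionSet

end WeakAFT

end

theorem mainTheorem1_general {V : Type u} [Category.{v} V] [MonoidalCategory V]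
    [SymmetricCategory V] [MonoidalClosed V] [ModelCategory V] [HasLimits V] [IsCofibrant (𝟙_ V)]
    {B : Type u₁} [EnrichedCategory V B] {A : Type u₂} [EnrichedCategory V A]
    (U : EnrichedFunctor V B A)
    (hB : WeakAFT.HasPowers V B) (hU : WeakAFT.PreservesPowers U)
    (R : WeakAFT.ReplacementChoice V)
    (hRB : WeakAFT.HasEnoughLimits B R) (hRU : WeakAFT.PreservesEnoughLimits R U) :
    WeakAFT.HasWeakLeftAdjoint (WeakAFT.shrinkable V) U ↔
      SolutionSetCondition.{v} U.forget := by
  refine ⟨WeakAFT.HasWeakLeftAdjoint.solutionSetCondition fun _ _ _ ⟨s, hs, _⟩ => ⟨s, hs⟩,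
    fun h X => ?_⟩
  obtain ⟨K, Y, f, hf⟩ := h (ForgetEnrichment.of V X)
  have := WeakAFT.CommaCategory.hasInitial_quotient_homotopic hRB hRU
    (fun k => StructuredArrow.mk (f k)) fun y => by
      obtain ⟨k, g, hg⟩ := hf y.right y.hom
      exact ⟨k, ⟨StructuredArrow.homMk g hg⟩⟩
  let hℓ : IsInitial (⊥_ Quotient (WeakAFT.CommaCategory.Homotopic U X)) := initialIsInitial
  exact ⟨_, _, WeakAFT.CommaCategory.isWeakReflection_of_isInitial hℓ hB hU⟩

theorem mainTheorem1 {V : Type u} [Category.{v} V] [MonoidalCategory V] [SymmetricCategory V]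
    [MonoidalClosed V] [ModelCategory V] [HasLimits V] [HasColimits V]
    [WeakAFT.MonoidalModelCategory V]
    {B : Type u₁} [EnrichedCategory V B] {A : Type u₂} [EnrichedCategory V A]
    (U : EnrichedFunctor V B A)
    (hB : WeakAFT.HasPowers V B) (hU : WeakAFT.PreservesPowers U)
    (R : WeakAFT.ReplacementChoice V)
    (hRB : WeakAFT.HasEnoughLimits B R) (hRU : WeakAFT.PreservesEnoughLimits R U) :
    WeakAFT.HasWeakLeftAdjoint (WeakAFT.shrinkable V) U ↔
      SolutionSetCondition.{v} U.forget := by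
  have := WeakAFT.MonoidalModelCategory.isCofibrant_unit (V := V)
  exact mainTheorem1_general U hB hU R hRB hRU
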